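/- Let $k\ge 1$, let $R$ be a commutative ring with $1$ and let $\Lambda$ be a row-finite, locally convex $k$-graph: a countable category with a degree functor $d:\Lambda\to\mathbb N^k$ satisfying the factorisation property (if $d(\lambda)=m+n$ there are unique $\mu,\nu$ with $\lambda=\mu\nu$, $d(\mu)=m$, $d(\nu)=n$), such that every $v\Lambda^n=\{\lambda: r(\lambda)=v,\ d(\lambda)=n\}$ is finite, and such that for all $i\ne j$, $\lambda\in v\Lambda^{e_i}$, $\mu\in v\Lambda^{e_j}$ the sets $s(\lambda)\Lambda^{e_j}$ and $s(\mu)\Lambda^{e_i}$ are nonempty. **Kumjian–Pask algebra.** Put $\Lambda^{\le n}=\{\lambda: d(\lambda)\le n,\text{ and } d(\lambda)_i<n_i \Rightarrow s(\lambda)\Lambda^{e_i}=\emptyset\}$. For a row-finite $k$-graph, $\mathrm{KP}_R(\Lambda)$ is the (not necessarily unital) $R$-algebra generated by $p_v$ ($v\in\Lambda^0$) and $s_\lambda,s_{\lambda^*}$ ($\lambda\in\Lambda$), with $s_v=s_{v^*}=p_v$ for vertices, subject to: $p_vp_w=\delta_{v,w}p_v$; $s_\lambda s_\mu=s_{\lambda\mu}$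 and $s_{\mu^*}s_{\lambda^*}=s_{(\lambda\mu)^*}$ if $s(\lambda)=r(\mu)$; $p_{r(\lambda)}s_\lambda=s_\lambda=s_\lambda p_{s(\lambda)}$ and $p_{s(\lambda)}s_{\lambda^*}=s_{\lambda^*}=s_{\lambda^*}p_{r(\lambda)}$; and, for all $n\in\mathbb N^k\setminus\{0\}$, $s_{\lambda^*}s_\mu=\delta_{\lambda,\mu}p_{s(\lambda)}$ for $\lambda,\mu\in\Lambda^{\le n}$ and $p_v=\sum_{\lambda\in v\Lambda^{\le n}}s_\lambda s_{\lambda^*}$, where $v\Lambda^{\le n}=\{\lambda\in\Lambda^{\le n}:r(\lambda)=v\}$. **Desourcification.** A boundary path $x$ of degree $d(x)\in(\mathbb N\cup\{\infty\})^k$ is a degree-preserving functor from $\Omega_{k,d(x)}=\{(p,q)\in\mathbb N^k\times\mathbb N^k:p\le q\le d(x)\}$ to $\Lambda$ such that $x(p)\Lambda^{e_i}=\emptyset$ whenever $p\le d(x)$ and $p_i=d(x)_i$. Its range is $x(0)$, and $\sigma^m(x)$ is its shift by $m\le d(x)$. The desourcification $\tilde\Lambda$ has as vertices the classes $[x;m]$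 ($x$ a boundary path, $m\in\mathbb N^k$) and as paths the classes $[x;(m,n)]$ ($m\le n$), where $(x;m)\approx(y;p)$ iff $x(m\wedge d(x))=y(p\wedge d(y))$ and $m-m\wedge d(x)=p-p\wedge d(y)$, and $(x;(m,n))\sim(y;(p,q))$ iff $x(m\wedge d(x),n\wedge d(x))=y(p\wedge d(y),q\wedge d(y))$, $m-m\wedge d(x)=p-p\wedge d(y)$ and $n-m=q-p$. It is a row-finite $k$-graph without sources with $r[x;(m,n)]=[x;m]$, $s[x;(m,n)]=[x;n]$, $d[x;(m,n)]=n-m$, identities $[x;(m,m)]$, and $[x;(m,n)]\circ[y;(p,q)]=[x(0,n\wedge d(x))\,\sigma^{p\wedge d(y)}(y);(m,n+q-p)]$. Let $\iota:\Lambda\to\tilde\Lambda$ be $\iota(\lambda)=[\lambda x;(0,d(\lambda))]$, where $x$ is any boundary path with range $s(\lambda)$, and $\iota(v)=[x;0]$, where $x$ is any boundary path with range $v$. Let $(q,t)$ be the generating family of $\mathrm{KP}_R(\tilde\Lambda)$. Let $B(\tilde\Lambda)$ be the $R$-subalgebra of $\mathrm{KP}_R(\tilde\Lambda)$ generated by $\{q_{\iota(v)},t_{\iota(\lambda)},t_{\iota(\mu)^*}: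 v\in\Lambda^0,\ \lambda,\mu\in\Lambda\}$, and $$M=\operatorname{span}_R\{t_\lambda t_{\mu^*}:\lambda,\mu\in\tilde\Lambda,\ r(\mu)\in\iota(\Lambda^0)\},\qquad N=\operatorname{span}_R\{t_\lambda t_{\mu^*}:\lambda,\mu\in\tilde\Lambda,\ r(\lambda)\in\iota(\Lambda^0)\}.$$ For rings $A,B$ (not necessarily unital), a *Morita context* $(A,B,M,N,\psi,\phi)$ consists of an $A$-$B$ bimodule $M$, a $B$-$A$ bimodule $N$ and bimodule homomorphisms $\psi:M\otimes_BN\to A$, $\phi:N\otimes_AM\to B$ with $n'\cdot\psi(m\otimes n)=\phi(n'\otimes m)\cdot n$ and $m'\cdot\phi(n\otimes m)=\psi(m'\otimes n)\cdot m$ for all $m,m'\in M$, $n,n'\in N$; it is *surjective* if $\psi$ and $\phi$ are surjective. **Theorem.** 1. Under multiplication in $\mathrm{KP}_R(\tilde\Lambda)$, $M$ is a $\mathrm{KP}_R(\tilde\Lambda)$-$B(\tilde\Lambda)$ bimodule and $N$ is a $B(\tilde\Lambda)$-$\mathrm{KP}_R(\tilde\Lambda)$ bimodule, and there are $\psi:M\otimes_{B(\tilde\Lambda)}N\to\mathrm{KP}_R(\tilde\Lambda)$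 and $\phi:N\otimes_{\mathrm{KP}_R(\tilde\Lambda)}M\to B(\tilde\Lambda)$ with $\psi(m\otimes n)=mn$ and $\phi(n\otimes m)=nm$ such that $(\mathrm{KP}_R(\tilde\Lambda),B(\tilde\Lambda),M,N,\psi,\phi)$ is a surjective Morita context. 2. There is an $R$-algebra isomorphism $\Phi:\mathrm{KP}_R(\Lambda)\to B(\tilde\Lambda)$ with $p_v\mapsto q_{\iota(v)}$, $s_\lambda\mapsto t_{\iota(\lambda)}$, $s_{\lambda^*}\mapsto t_{\iota(\lambda)^*}$. Letting $\mathrm{KP}_R(\Lambda)$ act on $M$ and $N$ through $\Phi$, the data $(\mathrm{KP}_R(\tilde\Lambda),\mathrm{KP}_R(\Lambda),M,N,\psi,\Phi^{-1}\circ\phi)$ form a surjective Morita context between $\mathrm{KP}_R(\tilde\Lambda)$ and $\mathrm{KP}_R(\Lambda)$. -/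

import Mathlib

universe u v w

noncomputable section

/-- A `k`-graph: a countable category with vertex (object) set `Vert`, path (morphism) set `Path`,
range (codomain) `r`, source (domain) `s`, identities `one`, composition `comp f g = f ∘ g`
(defined when `s f = r g`), and a degree functor `d` to `ℕ^k` with the factorisation property. -/
structure KGraph (k : ℕ) where
  Vert : Type u
  Path : Type u
  r : Path → Vert
  s : Path → Vert
  one : Vert → Path
  comp : (f g : Path) → s f = r g → Path
  d : Path → (Fin k → ℕ)
  countable : Countable Path
  r_one : ∀ v, r (one v) = v
  s_one : ∀ v, s (one v) = v
  r_comp : ∀ f g h, r (comp f g h) = r f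
  s_comp : ∀ f g h, s (comp f g h) = s g
  one_comp : ∀ f, comp (one (r f)) f (s_one _) = f
  comp_one : ∀ f, comp f (one (s f)) (r_one _).symm = f
  assoc : ∀ f g l (h : s f = r g) (h' : s g = r l),
    comp (comp f g h) l ((s_comp f g h).trans h') = comp f (comp g l h') (h.trans (r_comp g l h').symm)
  d_one : ∀ v, d (one v) = 0
  d_comp : ∀ f g h, d (comp f g h) = d f + d g
  factor : ∀ f m n, d f = m + n →
    ∃! p : Path × Path, d p.1 = m ∧ d p.2 = n ∧ ∃ h : s p.1 = r p.2, f = comp p.1 p.2 h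

namespace KGraph

variable {k : ℕ}

/-- The basis element `e_i` of `ℕ^k`. -/
def e (i : Fin k) : Fin k → ℕ := Pi.single i 1

/-- The set `vΛ^n`. -/
def pathsOf (Λ : KGraph.{u} k) (v : Λ.Vert) (n : Fin k → ℕ) : Set Λ.Path :=
  {f | Λ.r f = v ∧ Λ.d f = n}

/-- The set `Λ^{≤ n}`. -/
def maxPaths (Λ : KGraph.{u} k) (n : Fin k → ℕ) : Set Λ.Path :=
  {f | Λ.d f ≤ n ∧ ∀ i, Λ.d f i < n i → Λ.pathsOf (Λ.s f) (e i) = ∅}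

/-- The set `vΛ^{≤ n}`. -/
def maxPathsOf (Λ : KGraph.{u} k) (v : Λ.Vert) (n : Fin k → ℕ) : Set Λ.Path :=
  {f | Λ.r f = v ∧ f ∈ Λ.maxPaths n}

class RowFinite (Λ : KGraph.{u} k) : Prop where
  finite : ∀ v n, (Λ.pathsOf v n).Finite

class LocallyConvex (Λ : KGraph.{u} k) : Prop where
  nonempty : ∀ (v : Λ.Vert) (i j : Fin k), i ≠ j → ∀ f ∈ Λ.pathsOf v (e i), ∀ g ∈ Λ.pathsOf v (e j),
    (Λ.pathsOf (Λ.s f) (e j)).Nonempty ∧ (Λ.pathsOf (Λ.s g) (e i)).Nonempty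

/-- No vertex is a source, i.e. every `vΛ^n` is nonempty. -/
def NoSources (Λ : KGraph.{u} k) : Prop := ∀ v n, (Λ.pathsOf v n).Nonempty

theorem NoSources.locallyConvex {Λ : KGraph.{u} k} (h : Λ.NoSources) : Λ.LocallyConvex :=
  ⟨fun _ _ _ _ _ _ _ _ => ⟨h _ _, h _ _⟩⟩

theorem maxPathsOf_finite (Λ : KGraph.{u} k) [Λ.RowFinite] (v : Λ.Vert) (n : Fin k → ℕ) :
    (Λ.maxPathsOf v n).Finite :=
  ((Set.finite_Iic n).biUnion fun m _ => RowFinite.finite v m).subset fun f hf =>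
    Set.mem_biUnion (x := Λ.d f) hf.2.1 ⟨hf.1, rfl⟩

/-- A `k`-graph morphism: a degree-preserving functor. -/
structure Hom (Λ : KGraph.{u} k) (Γ : KGraph.{v} k) where
  onVert : Λ.Vert → Γ.Vert
  onPath : Λ.Path → Γ.Path
  map_r : ∀ f, Γ.r (onPath f) = onVert (Λ.r f)
  map_s : ∀ f, Γ.s (onPath f) = onVert (Λ.s f)
  map_one : ∀ v, onPath (Λ.one v) = Γ.one (onVert v)
  map_comp : ∀ f g h, onPath (Λ.comp f g h) =
    Γ.comp (onPath f) (onPath g) ((map_s f).trans ((congrArg onVert h).trans (map_r g).symm))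
  map_d : ∀ f, Γ.d (onPath f) = Λ.d f

/-! ### Elementary facts on factorisations -/

/-- `f` composes with `g` to `h`. -/
def IsComp (Λ : KGraph.{u} k) (f g h : Λ.Path) : Prop := ∃ e : Λ.s f = Λ.r g, Λ.comp f g e = h

/-- `f` is an initial segment of `h`. -/
def Pfx (Λ : KGraph.{u} k) (f h : Λ.Path) : Prop := ∃ g, Λ.IsComp f g h

section lemmas
variable {Λ : KGraph.{u} k}

theorem IsComp.deg {f g h : Λ.Path} (H : Λ.IsComp f g h) : Λ.d h = Λ.d f + Λ.d g := by
  obtain ⟨e, rfl⟩ := H; exact Λ.d_comp _ _ _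
theorem IsComp.r {f g h : Λ.Path} (H : Λ.IsComp f g h) : Λ.r h = Λ.r f := by
  obtain ⟨e, rfl⟩ := H; exact Λ.r_comp _ _ _
theorem IsComp.s {f g h : Λ.Path} (H : Λ.IsComp f g h) : Λ.s h = Λ.s g := by
  obtain ⟨e, rfl⟩ := H; exact Λ.s_comp _ _ _
theorem IsComp.unique {f g h h' : Λ.Path} (H : Λ.IsComp f g h) (H' : Λ.IsComp f g h') : h = h' := by
  obtain ⟨e, rfl⟩ := H; obtain ⟨e', rfl⟩ := H'; rfl

theorem IsComp.assoc {f g h l fg gh : Λ.Path} (H : Λ.IsComp f g fg) (H' : Λ.IsComp fg h l)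
    (H'' : Λ.IsComp g h gh) : Λ.IsComp f gh l := by
  obtain ⟨e, rfl⟩ := H; obtain ⟨e', rfl⟩ := H'; obtain ⟨e'', rfl⟩ := H''
  exact ⟨_, (Λ.assoc f g h e e'').symm⟩

theorem IsComp.assoc' {f g h l fg gh : Λ.Path} (H : Λ.IsComp f g fg) (H' : Λ.IsComp f gh l)
    (H'' : Λ.IsComp g h gh) : Λ.IsComp fg h l := by
  obtain ⟨e, rfl⟩ := H; obtain ⟨e', rfl⟩ := H'; obtain ⟨e'', rfl⟩ := H''
  exact ⟨_, Λ.assoc f g h e e''⟩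

theorem IsComp.exists_right {f g h fg l : Λ.Path} (H : Λ.IsComp f g fg) (H' : Λ.IsComp fg h l) :
    ∃ gh, Λ.IsComp g h gh :=
  ⟨_, H.s.symm.trans H'.1, rfl⟩

theorem IsComp.exists_left {f g h gh l : Λ.Path} (H : Λ.IsComp g h gh) (H' : Λ.IsComp f gh l) :
    ∃ fg, Λ.IsComp f g fg :=
  ⟨_, H'.1.trans H.r, rfl⟩

theorem isComp_one (f : Λ.Path) : Λ.IsComp f (Λ.one (Λ.s f)) f := ⟨_, Λ.comp_one f⟩
theorem one_isComp (f : Λ.Path) : Λ.IsComp (Λ.one (Λ.r f)) f f := ⟨_, Λ.one_comp f⟩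

theorem IsComp.cancel {f g f' g' h : Λ.Path} (H : Λ.IsComp f g h) (H' : Λ.IsComp f' g' h)
    (hd : Λ.d f = Λ.d f') : f = f' ∧ g = g' := by
  have hg : Λ.d g = Λ.d g' := by
    have h1 := H.deg; have h2 := H'.deg
    rw [h1, hd] at h2; exact add_left_cancel h2
  obtain ⟨p, -, hp⟩ := Λ.factor h _ _ H.deg
  obtain ⟨e, he⟩ := H
  obtain ⟨e', he'⟩ := H'
  have a := hp (f, g) ⟨rfl, rfl, e, he.symm⟩
  have b := hp (f', g') ⟨hd.symm, hg.symm, e', he'.symm⟩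
  simpa using a.trans b.symm

theorem exists_isComp (f : Λ.Path) (m n : Fin k → ℕ) (h : Λ.d f = m + n) :
    ∃ g l, Λ.IsComp g l f ∧ Λ.d g = m ∧ Λ.d l = n := by
  obtain ⟨⟨g, l⟩, ⟨h1, h2, e, h3⟩, -⟩ := Λ.factor f m n h
  exact ⟨g, l, ⟨e, h3.symm⟩, h1, h2⟩

theorem eq_one_of_d (f : Λ.Path) (h : Λ.d f = 0) : f = Λ.one (Λ.r f) :=
  ((isComp_one f).cancel (one_isComp f) (by rw [h, Λ.d_one])).1

theorem exists_pfx (f : Λ.Path) (m : Fin k → ℕ) (h : m ≤ Λ.d f) : ∃ g, Λ.Pfx g f ∧ Λ.d g = m := by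
  obtain ⟨g, l, h1, h2, h3⟩ := exists_isComp f m (Λ.d f - m) (by rw [add_tsub_cancel_of_le h])
  exact ⟨g, ⟨l, h1⟩, h2⟩

theorem Pfx.refl (f : Λ.Path) : Λ.Pfx f f := ⟨_, isComp_one f⟩
theorem Pfx.trans {f g h : Λ.Path} (H : Λ.Pfx f g) (H' : Λ.Pfx g h) : Λ.Pfx f h := by
  obtain ⟨a, ha⟩ := H; obtain ⟨b, hb⟩ := H'
  obtain ⟨c, hc⟩ := ha.exists_right hb
  exact ⟨c, ha.assoc hb hc⟩
theorem Pfx.deg {f h : Λ.Path} (H : Λ.Pfx f h) : Λ.d f ≤ Λ.d h := by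
  obtain ⟨a, ha⟩ := H; rw [ha.deg]; exact le_self_add
theorem Pfx.r {f h : Λ.Path} (H : Λ.Pfx f h) : Λ.r h = Λ.r f := H.choose_spec.r
theorem Pfx.eq {f g h : Λ.Path} (H : Λ.Pfx f h) (H' : Λ.Pfx g h) (hd : Λ.d f = Λ.d g) : f = g :=
  (H.choose_spec.cancel H'.choose_spec hd).1
theorem Pfx.of_le {f g h : Λ.Path} (H : Λ.Pfx f h) (H' : Λ.Pfx g h) (hd : Λ.d f ≤ Λ.d g) :
    Λ.Pfx f g := by
  obtain ⟨a, ha, had⟩ := exists_pfx g (Λ.d f) hd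
  rwa [H.eq (ha.trans H') had.symm]

/-- If `Λ` is locally convex, an edge of degree `e_i` can be moved along a path whose degree has
`i`-th coordinate zero. -/
theorem move_edge [Λ.LocallyConvex] (i : Fin k) : ∀ (N : ℕ) (f : Λ.Path), ∑ j, Λ.d f j = N →
    Λ.d f i = 0 → (Λ.pathsOf (Λ.r f) (e i)).Nonempty → (Λ.pathsOf (Λ.s f) (e i)).Nonempty := by
  intro N
  induction N with
  | zero =>
    intro f hf _ h
    have : Λ.d f = 0 := by
      funext j; exact (Finset.sum_eq_zero_iff.1 hf) j (Finset.mem_univ j)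
    rw [eq_one_of_d f this, Λ.s_one]; exact h
  | succ N ih =>
    intro f hf hi h
    obtain ⟨j, hj⟩ : ∃ j, Λ.d f j ≠ 0 := by
      by_contra! hc
      simp [hc] at hf
    have hij : j ≠ i := by rintro rfl; exact hj hi
    have hle : e j ≤ Λ.d f := by
      intro l
      by_cases hl : l = j
      · subst hl; simp [e]; omega
      · simp [e, hl]
    obtain ⟨g, l, h1, h2, h3⟩ := exists_isComp f (e j) (Λ.d f - e j)
      (by rw [add_tsub_cancel_of_le hle])
    have hs : ∑ x, Λ.d f x = 1 + ∑ x, Λ.d l x := by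
      rw [h1.deg, h2]; simp [Finset.sum_add_distrib, e]
    rw [h1.s]
    refine ih l (by omega) (by rw [h3]; simp [hi]) ?_
    obtain ⟨a, ha⟩ := h
    rw [← h1.1]
    exact (LocallyConvex.nonempty _ j i hij g ⟨h1.r.symm, h2⟩ a ha).1

end lemmas

/-! ### Boundary paths -/

/-- The `k`-graph `Ω_{k,m}` for `m ∈ (ℕ ∪ {∞})^k`. -/
def Omega (m : Fin k → ℕ∞) : KGraph.{0} k where
  Vert := {p : Fin k → ℕ // ∀ i, (p i : ℕ∞) ≤ m i}
  Path := {c : (Fin k → ℕ) × (Fin k → ℕ) // c.1 ≤ c.2 ∧ ∀ i, (c.2 i : ℕ∞) ≤ m i}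
  r c := ⟨c.1.1, fun i => (Nat.cast_le.2 (c.2.1 i)).trans (c.2.2 i)⟩
  s c := ⟨c.1.2, c.2.2⟩
  one p := ⟨(p.1, p.1), le_rfl, p.2⟩
  comp f g h := ⟨(f.1.1, g.1.2), f.2.1.trans ((congrArg Subtype.val h).trans_le g.2.1), g.2.2⟩
  d c := c.1.2 - c.1.1
  countable := inferInstance
  r_one _ := rfl
  s_one _ := rfl
  r_comp _ _ _ := rfl
  s_comp _ _ _ := rfl
  one_comp _ := rfl
  comp_one _ := rfl
  assoc _ _ _ _ _ := rfl
  d_one _ := tsub_self _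
  d_comp f g h := by
    have h' : f.1.2 = g.1.1 := congrArg Subtype.val h
    funext i
    have h1 : f.1.1 i ≤ f.1.2 i := f.2.1 i
    have h2 : g.1.1 i ≤ g.1.2 i := g.2.1 i
    have h3 := congrFun h' i
    simp only [Pi.add_apply, Pi.sub_apply]; omega
  factor f m' n h := by
    have hm : ∀ i, f.1.2 i = f.1.1 i + m' i + n i := fun i => by
      have := congrFun h i; have := f.2.1 i; simp at *; omega
    refine ⟨(⟨(f.1.1, f.1.1 + m'), fun i => by simp, fun i => le_trans (Nat.cast_le.2 ?_) (f.2.2 i)⟩,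
      ⟨(f.1.1 + m', f.1.2), fun i => ?_, f.2.2⟩), ⟨?_, ?_, rfl, rfl⟩, ?_⟩
    · have := hm i; simp; omega
    · have := hm i; simp; omega
    · funext i; simp
    · funext i; have := hm i; simp; omega
    · rintro ⟨⟨⟨a, b⟩, ha⟩, ⟨⟨c, d'⟩, hc⟩⟩ ⟨h1, h2, h3, h4⟩
      have h3' : b = c := congrArg Subtype.val h3
      have h4' : f.1 = (a, d') := congrArg Subtype.val h4
      subst h3'
      have hb : b = a + m' := by
        funext i; have := congrFun h1 i; have := ha.1 i; simp at *; omega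
      subst hb
      simp [h4']

/-- A boundary path of degree `deg`: a morphism `Ω_{k,deg} → Λ` sending sources to sources. -/
structure BoundaryPath (Λ : KGraph.{u} k) where
  deg : Fin k → ℕ∞
  toHom : Hom (Omega deg) Λ
  boundary : ∀ (p : (Omega deg).Vert) (i : Fin k),
    (Omega deg).maxPathsOf p (e i) = {(Omega deg).one p} →
      Λ.maxPathsOf (toHom.onVert p) (e i) = {Λ.one (toHom.onVert p)}

theorem maxPathsOf_e_eq_iff (Λ : KGraph.{u} k) (v : Λ.Vert) (i : Fin k) :
    Λ.maxPathsOf v (e i) = {Λ.one v} ↔ Λ.pathsOf v (e i) = ∅ := by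
  constructor
  · intro h
    by_contra hc
    obtain ⟨f, hf⟩ := Set.nonempty_iff_ne_empty.2 hc
    have : f ∈ Λ.maxPathsOf v (e i) := ⟨hf.1, hf.2.le, fun j hj => by rw [hf.2] at hj; omega⟩
    rw [h] at this
    have h2 := hf.2
    rw [this, Λ.d_one] at h2
    have := congrFun h2 i
    simp [e] at this
  · intro h
    ext f
    constructor
    · rintro ⟨h1, h2, h3⟩
      by_cases hi : Λ.d f i = 0
      · have : Λ.d f = 0 := by
          funext j
          by_cases hj : j = i
          · subst hj; exact hi
          · have := h2 j; simp [e, hj] at this; simpa using this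
        rw [Set.mem_singleton_iff, ← h1]; exact eq_one_of_d f this
      · exfalso
        have : Λ.d f = e i := by
          funext j
          have := h2 j
          by_cases hj : j = i
          · subst hj; simp [e] at *; omega
          · simp [e, hj] at *; omega
        have hf : f ∈ Λ.pathsOf v (e i) := ⟨h1, this⟩
        rw [h] at hf; exact hf
    · rintro rfl
      refine ⟨Λ.r_one v, by rw [Λ.d_one]; exact fun _ => Nat.zero_le _, fun j hj => ?_⟩
      have : j = i := by
        by_contra hji; simp [e, hji] at hj
      subst this
      rw [Λ.s_one, h]

theorem omega_pathsOf_eq_empty_iff (m : Fin k → ℕ∞) (p : (Omega m).Vert) (i : Fin k) :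
    (Omega m).pathsOf p (e i) = ∅ ↔ (p.1 i : ℕ∞) = m i := by
  constructor
  · intro h
    by_contra hc
    have hlt : (p.1 i : ℕ∞) < m i := lt_of_le_of_ne (p.2 i) hc
    have hf : (⟨(p.1, p.1 + e i), le_self_add, fun j => by
        by_cases hj : j = i
        · subst hj; simpa [e] using Order.add_one_le_of_lt hlt
        · simpa [e, hj] using p.2 j⟩ : (Omega m).Path) ∈ (Omega m).pathsOf p (e i) :=
      ⟨rfl, by change p.1 + e i - p.1 = e i; simp⟩
    rw [h] at hf; exact hf
  · intro h
    ext f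
    simp only [Set.mem_empty_iff_false, iff_false]
    rintro ⟨h1, h2⟩
    have h1' : f.1.1 = p.1 := congrArg Subtype.val h1
    have h3 := congrFun h2 i
    change f.1.2 i - f.1.1 i = e i i at h3
    have h4 := f.2.2 i
    rw [← h, Nat.cast_le, ← h1'] at h4
    simp [e] at h3; omega

namespace BoundaryPath
variable {Λ : KGraph.{u} k}

/-- The path `x(p,q)`, for `p ≤ q ≤ d(x)`. -/
def seg (x : Λ.BoundaryPath) (p q : Fin k → ℕ) (h : p ≤ q) (hq : ∀ i, (q i : ℕ∞) ≤ x.deg i) :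
    Λ.Path :=
  x.toHom.onPath ⟨(p, q), h, hq⟩

/-- The vertex `x(p)`, for `p ≤ d(x)`. -/
def vert (x : Λ.BoundaryPath) (p : Fin k → ℕ) (hp : ∀ i, (p i : ℕ∞) ≤ x.deg i) : Λ.Vert :=
  x.toHom.onVert ⟨p, hp⟩

/-- The range `r(x) = x(0)`. -/
def range (x : Λ.BoundaryPath) : Λ.Vert := x.vert 0 fun _ => by simp

variable (x : Λ.BoundaryPath)

theorem seg_isComp (p q l : Fin k → ℕ) (h : p ≤ q) (h' : q ≤ l) (hl : ∀ i, (l i : ℕ∞) ≤ x.deg i) :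
    Λ.IsComp (x.seg p q h fun i => (Nat.cast_le.2 (h' i)).trans (hl i)) (x.seg q l h' hl)
      (x.seg p l (h.trans h') hl) :=
  ⟨_, (x.toHom.map_comp ⟨(p, q), h, fun i => (Nat.cast_le.2 (h' i)).trans (hl i)⟩
    ⟨(q, l), h', hl⟩ rfl).symm⟩

theorem d_seg (p q : Fin k → ℕ) (h : p ≤ q) (hq : ∀ i, (q i : ℕ∞) ≤ x.deg i) :
    Λ.d (x.seg p q h hq) = q - p := x.toHom.map_d _

theorem r_seg (p q : Fin k → ℕ) (h : p ≤ q) (hq : ∀ i, (q i : ℕ∞) ≤ x.deg i) :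
    Λ.r (x.seg p q h hq) = x.vert p fun i => (Nat.cast_le.2 (h i)).trans (hq i) := x.toHom.map_r _

theorem s_seg (p q : Fin k → ℕ) (h : p ≤ q) (hq : ∀ i, (q i : ℕ∞) ≤ x.deg i) :
    Λ.s (x.seg p q h hq) = x.vert q hq := x.toHom.map_s _

theorem seg_self (p : Fin k → ℕ) (hq : ∀ i, (p i : ℕ∞) ≤ x.deg i) :
    x.seg p p le_rfl hq = Λ.one (x.vert p hq) := x.toHom.map_one ⟨p, hq⟩

theorem no_edge (p : Fin k → ℕ) (hp : ∀ i, (p i : ℕ∞) ≤ x.deg i) (i : Fin k)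
    (hi : (p i : ℕ∞) = x.deg i) : Λ.pathsOf (x.vert p hp) (e i) = ∅ :=
  (maxPathsOf_e_eq_iff Λ _ i).1 (x.boundary ⟨p, hp⟩ i
    ((maxPathsOf_e_eq_iff _ _ i).2 ((omega_pathsOf_eq_empty_iff _ _ i).2 hi)))

/-- A boundary path is determined by its initial segments `pre n = x(0,n)`. -/
theorem exists_ofPrefix (D : Fin k → ℕ∞) (pre : (n : Fin k → ℕ) → (∀ i, (n i : ℕ∞) ≤ D i) → Λ.Path)
    (hd : ∀ n hn, Λ.d (pre n hn) = n)
    (hp : ∀ n n' hn hn', n ≤ n' → Λ.Pfx (pre n hn) (pre n' hn'))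
    (hb : ∀ n hn i, (n i : ℕ∞) = D i → Λ.pathsOf (Λ.s (pre n hn)) (e i) = ∅) :
    ∃ x : Λ.BoundaryPath, ∃ h : x.deg = D, ∀ p q (hpq : p ≤ q) (hq : ∀ i, (q i : ℕ∞) ≤ D i),
      Λ.IsComp (pre p fun i => (Nat.cast_le.2 (hpq i)).trans (hq i))
        (x.seg p q hpq (by rwa [h])) (pre q hq) := by
  have H : ∀ c : (Omega D).Path, ∃ g, Λ.IsComp (pre _ ((Omega D).r c).2) g (pre _ ((Omega D).s c).2) :=
    fun c => hp _ _ _ _ c.2.1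
  choose G hG using H
  have hGr : ∀ c, Λ.r (G c) = Λ.s (pre _ ((Omega D).r c).2) := fun c => (hG c).1.symm
  have hGs : ∀ c, Λ.s (G c) = Λ.s (pre _ ((Omega D).s c).2) := fun c => (hG c).s.symm
  refine ⟨⟨D, ⟨fun p => Λ.s (pre p.1 p.2), G, hGr, hGs, ?_, ?_, ?_⟩, ?_⟩, rfl, ?_⟩
  · intro p
    exact ((hG _).cancel (isComp_one _) rfl).2
  · intro f g h
    have h1 := hG f
    have h2 := hG g
    have h3 := hG ((Omega D).comp f g h)
    have key : pre _ ((Omega D).s f).2 = pre _ ((Omega D).r g).2 := by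
      rw [h]
    have h1' : Λ.IsComp (pre _ ((Omega D).r f).2) (G f) (pre _ ((Omega D).r g).2) := key ▸ h1
    have h4 : Λ.s (G f) = Λ.r (G g) := by rw [hGs, hGr, h]
    exact (h3.cancel (h1'.assoc h2 ⟨h4, rfl⟩) rfl).2
  · intro f
    have := (hG f).deg
    rw [hd, hd] at this
    have h' : (Omega D).d f = ((Omega D).s f).1 - ((Omega D).r f).1 := rfl
    rw [h', this]; simp
  · intro p i
    rw [maxPathsOf_e_eq_iff, maxPathsOf_e_eq_iff, omega_pathsOf_eq_empty_iff]
    exact hb p.1 p.2 i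
  · intro p q hpq hq
    exact hG ⟨(p, q), hpq, hq⟩

/-- Concatenation `λ σ^p(y)`. -/
theorem exists_concat [Λ.LocallyConvex] (f : Λ.Path) (y : Λ.BoundaryPath) (p : Fin k → ℕ)
    (hp : ∀ i, (p i : ℕ∞) ≤ y.deg i) (hf : Λ.s f = y.vert p hp) :
    ∃ z : Λ.BoundaryPath, (∀ i, z.deg i + p i = Λ.d f i + y.deg i) ∧
      (∀ h, z.seg 0 (Λ.d f) (fun _ => Nat.zero_le _) h = f) ∧
      ∀ a b h h' h1 h2, z.seg (Λ.d f + a) (Λ.d f + b) h h' = y.seg (p + a) (p + b) h1 h2 := by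
  set D : Fin k → ℕ∞ := fun i => Λ.d f i + (y.deg i - p i) with hD
  have hn' : ∀ n : Fin k → ℕ, (∀ i, (n i : ℕ∞) ≤ D i) →
      ∀ i, ((p + (n - Λ.d f)) i : ℕ∞) ≤ y.deg i := by
    intro n hn i
    have h1 := hn i; have h2 := hp i
    simp only [hD] at h1
    rcases hy : y.deg i with _ | t
    · exact le_top
    · rw [hy] at h1 h2
      simp only [Pi.add_apply, Pi.sub_apply]
      erw [Nat.cast_le] at h2 ⊢
      have h1' : (n i : ℕ∞) ≤ ((Λ.d f i + (t - p i) : ℕ) : ℕ∞) := by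
        push_cast; exact h1
      rw [Nat.cast_le] at h1'; omega
  have hpn : ∀ n : Fin k → ℕ, p ≤ p + (n - Λ.d f) := fun n => le_self_add
  let L : (n : Fin k → ℕ) → (∀ i, (n i : ℕ∞) ≤ D i) → Λ.Path := fun n hn =>
    Λ.comp f (y.seg p (p + (n - Λ.d f)) (hpn n) (hn' n hn)) (by rw [hf, r_seg])
  have hLd : ∀ n hn, Λ.d (L n hn) = Λ.d f + (n - Λ.d f) := by
    intro n hn; rw [Λ.d_comp, d_seg]; simp
  have hLP : ∀ n n' hn hn', n ≤ n' → Λ.Pfx (L n hn) (L n' hn') := by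
    intro n n' hn hn'' hle
    have hle' : p + (n - Λ.d f) ≤ p + (n' - Λ.d f) := by gcongr
    have := y.seg_isComp p _ _ (hpn n) hle' (hn' n' hn'')
    exact ⟨_, IsComp.assoc' ⟨_, rfl⟩ ⟨_, rfl⟩ this⟩
  have hex : ∀ n hn, ∃ g, Λ.Pfx g (L n hn) ∧ Λ.d g = n := fun n hn =>
    exists_pfx (L n hn) n (by rw [hLd n hn]; exact le_add_tsub)
  choose pre hpre hpred using hex
  have hpp : ∀ n n' hn hn', n ≤ n' → Λ.Pfx (pre n hn) (pre n' hn') := fun n n' hn hn'' hle =>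
    ((hpre n hn).trans (hLP n n' hn hn'' hle)).of_le (hpre n' hn'') (by rwa [hpred, hpred])
  have hpreL : ∀ n hn, Λ.d f ≤ n → pre n hn = L n hn := fun n hn hle =>
    (hpre n hn).eq (Pfx.refl (L n hn)) (by rw [hpred, hLd n hn, add_tsub_cancel_of_le hle])
  have hdf : ∀ i, (Λ.d f i : ℕ∞) ≤ D i := fun i => le_self_add
  obtain ⟨z, hz, hseg⟩ := exists_ofPrefix D pre hpred hpp (by
    intro n hn i hi
    by_contra hc
    have hne := Set.nonempty_iff_ne_empty.2 hc
    have hsup : ∀ j, ((n ⊔ Λ.d f) j : ℕ∞) ≤ D j := fun j => by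
      rcases le_total (n j) (Λ.d f j) with h | h
      · rw [Pi.sup_apply, sup_eq_right.2 h]; exact hdf j
      · rw [Pi.sup_apply, sup_eq_left.2 h]; exact hn j
    obtain ⟨g, hg⟩ := hpp n (n ⊔ Λ.d f) hn hsup le_sup_left
    have hni : Λ.d f i ≤ n i := by
      have := hdf i; rw [← hi, Nat.cast_le] at this; exact this
    have hgd : Λ.d g i = 0 := by
      have := congrFun hg.deg i
      rw [hpred, hpred] at this
      simp at this; omega
    rw [hg.1] at hne
    have := move_edge i _ g rfl hgd hne
    rw [← hg.s, hpreL _ _ le_sup_right] at this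
    simp only [L] at this
    rw [Λ.s_comp, s_seg, y.no_edge _ _ i] at this
    · exact Set.not_nonempty_empty this
    · have h2 := hp i
      simp only [hD] at hi
      rcases hy : y.deg i with _ | t
      · rw [hy] at hi; exfalso
        change (n i : ℕ∞) = (Λ.d f i : ℕ∞) + (⊤ - (p i : ℕ∞)) at hi
        rw [ENat.top_sub_natCast, add_top] at hi
        exact ENat.natCast_ne_top _ hi
      · rw [hy] at hi h2
        change (p i : ℕ∞) ≤ (t : ℕ∞) at h2
        change (n i : ℕ∞) = (Λ.d f i : ℕ∞) + ((t : ℕ∞) - (p i : ℕ∞)) at hi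
        change _ = (t : ℕ∞)
        norm_cast at *
        simp; omega)
  have hL : ∀ n hn q (hq : q = p + (n - Λ.d f)) h1 h2, Λ.IsComp f (y.seg p q h1 h2) (L n hn) := by
    rintro n hn q rfl h1 h2; exact ⟨_, rfl⟩
  refine ⟨z, ?_, ?_, ?_⟩
  · intro i
    have h2 := hp i
    rw [hz, congrFun hD i, add_assoc, tsub_add_cancel_of_le h2]
  · intro h
    have h0 := hseg 0 (Λ.d f) (fun _ => Nat.zero_le _) hdf
    have h1 := hL (Λ.d f) hdf p (by simp) le_rfl hp
    rw [seg_self, ← hf] at h1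
    rw [hpreL _ _ le_rfl, ← (isComp_one f).unique h1] at h0
    exact (h0.cancel (one_isComp f) (by rw [hpred, Λ.d_one])).2
  · intro a b h h' h1 h2
    have hb : ∀ i, ((Λ.d f + b) i : ℕ∞) ≤ D i := by rw [← hz]; exact h'
    have ha : ∀ i, ((Λ.d f + a) i : ℕ∞) ≤ D i := fun i => (Nat.cast_le.2 (h i)).trans (hb i)
    have h3 := hseg _ _ h hb
    rw [hpreL _ _ le_self_add, hpreL _ _ le_self_add] at h3
    have h5 := hL _ ha (p + a) (by simp) le_self_add fun i => (Nat.cast_le.2 (h1 i)).trans (h2 i)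
    have h6 := hL _ hb (p + b) (by simp) le_self_add h2
    exact (h3.cancel (h5.assoc' h6 (y.seg_isComp _ _ _ _ h1 h2)) rfl).2


/-- The boundary path `λ σ^p(y)`, where `p ≤ d(y)` and `s(λ) = y(p)`. -/
def concat [Λ.LocallyConvex] (f : Λ.Path) (y : Λ.BoundaryPath) (p : Fin k → ℕ)
    (hp : ∀ i, (p i : ℕ∞) ≤ y.deg i) (hf : Λ.s f = y.vert p hp) : Λ.BoundaryPath :=
  (exists_concat f y p hp hf).choose

theorem concat_spec_aux [Λ.LocallyConvex] (f : Λ.Path) (y : Λ.BoundaryPath) (p : Fin k → ℕ)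
    (hp : ∀ i, (p i : ℕ∞) ≤ y.deg i) (hf : Λ.s f = y.vert p hp) :
    (∀ i, (concat f y p hp hf).deg i + p i = Λ.d f i + y.deg i) ∧
      (∀ h, (concat f y p hp hf).seg 0 (Λ.d f) (fun _ => Nat.zero_le _) h = f) ∧
      ∀ a b h h' h1 h2, (concat f y p hp hf).seg (Λ.d f + a) (Λ.d f + b) h h' =
        y.seg (p + a) (p + b) h1 h2 :=
  (exists_concat f y p hp hf).choose_spec

theorem seg_congr {p q p' q' : Fin k → ℕ} (hp : p = p') (hq : q = q') (h : p ≤ q)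
    (h' : ∀ i, (q i : ℕ∞) ≤ x.deg i) :
    x.seg p q h h' = x.seg p' q' (hp ▸ hq ▸ h) (hq ▸ h') := by
  subst hp; subst hq; rfl

theorem vert_congr {p p' : Fin k → ℕ} (hp : p = p') (h' : ∀ i, (p i : ℕ∞) ≤ x.deg i) :
    x.vert p h' = x.vert p' (hp ▸ h') := by
  subst hp; rfl

theorem concat_spec [Λ.LocallyConvex] (f : Λ.Path) (y : Λ.BoundaryPath) (p : Fin k → ℕ)
    (hp : ∀ i, (p i : ℕ∞) ≤ y.deg i) (hf : Λ.s f = y.vert p hp) (A : Fin k → ℕ) (hA : Λ.d f = A)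
    (q : Fin k → ℕ) (hpq : p ≤ q) (hq : ∀ i, (q i : ℕ∞) ≤ y.deg i) :
    (∀ i, (concat f y p hp hf).deg i + p i = A i + y.deg i) ∧
      (∀ h, (concat f y p hp hf).seg 0 A (fun _ => Nat.zero_le _) h = f) ∧
      ∀ h, (concat f y p hp hf).seg A (A + (q - p)) le_self_add h = y.seg p q hpq hq := by
  subst hA
  obtain ⟨h1, h2, h3⟩ := concat_spec_aux f y p hp hf
  refine ⟨h1, h2, fun h => ?_⟩
  have e : p + (q - p) = q := add_tsub_cancel_of_le hpq
  have := h3 0 (q - p) (by simp) h (by simp) (by rw [e]; exact hq)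
  rw [y.seg_congr (add_zero p) e, BoundaryPath.seg_congr _ (add_zero _) rfl] at this
  exact this

end BoundaryPath

theorem exists_maxPath_aux {Λ : KGraph.{u} k} (n : Fin k → ℕ) : ∀ (N : ℕ) (f : Λ.Path), Λ.d f ≤ n →
    ∑ i, (n i - Λ.d f i) = N → ∃ g, Λ.r g = Λ.r f ∧ g ∈ Λ.maxPaths n := by
  intro N
  induction N using Nat.strong_induction_on with
  | _ N ih =>
    intro f hf hN
    by_cases hm : f ∈ Λ.maxPaths n
    · exact ⟨f, rfl, hm⟩
    · simp only [maxPaths, Set.mem_ofPred_eq, hf, true_and, not_forall] at hm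
      obtain ⟨i, hi, hne⟩ := hm
      obtain ⟨a, ha, had⟩ := Set.nonempty_iff_ne_empty.2 hne
      have hd : ∀ j, Λ.d (Λ.comp f a ha.symm) j = Λ.d f j + e i j := fun j => by
        rw [Λ.d_comp, had]; rfl
      obtain ⟨g, hg, hg'⟩ := ih (∑ j, (n j - Λ.d (Λ.comp f a ha.symm) j)) (by
        rw [← hN]
        refine Finset.sum_lt_sum (fun j _ => ?_) ⟨i, Finset.mem_univ i, ?_⟩
        · rw [hd]; omega
        · rw [hd]; simp [e]; omega) (Λ.comp f a ha.symm) (by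
        intro j
        rw [hd]
        by_cases hj : j = i
        · subst hj; simp [e]; omega
        · simp [e, hj]; exact hf j) rfl
      exact ⟨g, hg.trans (Λ.r_comp _ _ _), hg'⟩

theorem exists_maxPath {Λ : KGraph.{u} k} (v : Λ.Vert) (n : Fin k → ℕ) :
    ∃ g, Λ.r g = v ∧ g ∈ Λ.maxPaths n := by
  obtain ⟨g, h1, h2⟩ := exists_maxPath_aux n _ (Λ.one v) (by rw [Λ.d_one]; exact fun _ => Nat.zero_le _) rfl
  exact ⟨g, h1.trans (Λ.r_one v), h2⟩

/-- Every vertex is the range of a boundary path. -/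
theorem exists_boundaryPath (Λ : KGraph.{u} k) [Λ.LocallyConvex] (v : Λ.Vert) :
    ∃ x : Λ.BoundaryPath, x.range = v := by
  choose step hstep hmax using fun w : Λ.Vert => exists_maxPath w (fun _ => 1)
  let F : ℕ → Λ.Path := fun N => Nat.rec (Λ.one v)
    (fun _ f => Λ.comp f (step (Λ.s f)) (hstep _).symm) N
  have hF0 : F 0 = Λ.one v := rfl
  have hF : ∀ N, Λ.IsComp (F N) (step (Λ.s (F N))) (F (N + 1)) := fun N => ⟨_, rfl⟩
  have hmono : ∀ N M, N ≤ M → Λ.Pfx (F N) (F M) := by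
    intro N M h
    induction h with
    | refl => exact Pfx.refl _
    | step _ ih => exact ih.trans ⟨_, hF _⟩
  let D : Fin k → ℕ∞ := fun i => ⨆ N, (Λ.d (F N) i : ℕ∞)
  have hFD : ∀ N i, (Λ.d (F N) i : ℕ∞) ≤ D i := fun N i => le_iSup (fun N => (Λ.d (F N) i : ℕ∞)) N
  have hN : ∀ n : Fin k → ℕ, (∀ i, (n i : ℕ∞) ≤ D i) → ∃ N, n ≤ Λ.d (F N) := by
    intro n hn
    have : ∀ i, ∃ N, n i ≤ Λ.d (F N) i := by
      intro i
      by_contra! hc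
      have h1 : D i ≤ ((n i - 1 : ℕ) : ℕ∞) :=
        iSup_le fun N => Nat.cast_le.2 (by have := hc N; omega)
      have h2 := Nat.cast_le.1 ((hn i).trans h1)
      have := hc 0
      omega
    choose T hT using this
    refine ⟨Finset.univ.sup T, fun i => (hT i).trans ?_⟩
    exact (hmono _ _ (Finset.le_sup (Finset.mem_univ i))).deg i
  choose T hT using hN
  choose pre hpre hpred using fun n hn => exists_pfx _ n (hT n hn)
  obtain ⟨x, hx, hseg⟩ := BoundaryPath.exists_ofPrefix D pre hpred (by
    intro n n' hn hn' hle
    have h1 := (hpre n hn).trans (hmono _ (max (T n hn) (T n' hn')) (le_max_left _ _))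
    have h2 := (hpre n' hn').trans (hmono _ (max (T n hn) (T n' hn')) (le_max_right _ _))
    exact h1.of_le h2 (by rwa [hpred, hpred])) (by
    intro n hn i hi
    by_contra hc
    have hne := Set.nonempty_iff_ne_empty.2 hc
    have h1 : Λ.d (F (T n hn + 1)) i ≤ n i := by
      have := hFD (T n hn + 1) i; rw [← hi] at this; exact Nat.cast_le.1 this
    have h2 : n i ≤ Λ.d (F (T n hn)) i := hT n hn i
    have h3 := congrFun (hF (T n hn)).deg i
    rw [Pi.add_apply] at h3
    have h4 := (hmax (Λ.s (F (T n hn)))).2 i (by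
      change Λ.d (step (Λ.s (F (T n hn)))) i < 1; omega)
    rw [← (hF (T n hn)).s] at h4
    obtain ⟨g, hg⟩ := (hpre n hn).trans (hmono _ (T n hn + 1) (Nat.le_succ _))
    rw [hg.1] at hne
    have h5 := congrFun hg.deg i
    rw [hpred, Pi.add_apply] at h5
    have h6 := move_edge i _ g rfl (by omega) hne
    rw [← hg.s, h4] at h6
    exact Set.not_nonempty_empty h6)
  refine ⟨x, ?_⟩
  have h := hseg 0 0 le_rfl (fun _ => by simp)
  rw [x.seg_self] at h
  have h1 := h.1
  rw [Λ.r_one] at h1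
  have h2 := hpre 0 (fun _ => by simp)
  rw [eq_one_of_d _ (hpred _ _), Λ.s_one] at h1
  have h3 := (hmono 0 (T 0 fun _ => by simp) (Nat.zero_le _)).r
  rw [h2.r, hF0, Λ.r_one] at h3
  exact h1.symm.trans h3

/-! ### The desourcification -/

/-- The meet `m ∧ D` of `m ∈ ℕ^k` and `D ∈ (ℕ ∪ {∞})^k`. -/
def meet (m : Fin k → ℕ) (D : Fin k → ℕ∞) : Fin k → ℕ := fun i => (min (m i : ℕ∞) (D i)).toNat

theorem meet_cases (m : Fin k → ℕ) (D : Fin k → ℕ∞) (i : Fin k) :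
    (D i = ⊤ ∧ meet m D i = m i) ∨ ∃ t : ℕ, D i = t ∧ meet m D i = min (m i) t := by
  rcases h : D i with _ | t
  · left; refine ⟨rfl, ?_⟩
    simp only [meet, h]
    change (min (m i : ℕ∞) ⊤).toNat = m i
    simp
  · right; refine ⟨t, rfl, ?_⟩
    simp only [meet, h]
    change (min (m i : ℕ∞) (t : ℕ∞)).toNat = _
    rcases le_total (m i) t with h' | h'
    · rw [min_eq_left h', min_eq_left (Nat.cast_le.2 h')]; rfl
    · rw [min_eq_right h', min_eq_right (Nat.cast_le.2 h')]; rfl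

theorem meet_le (m : Fin k → ℕ) (D : Fin k → ℕ∞) : meet m D ≤ m := fun i => by
  change meet m D i ≤ m i
  rcases meet_cases m D i with ⟨_, h⟩ | ⟨t, _, h⟩ <;> omega

theorem meet_le_right (m : Fin k → ℕ) (D : Fin k → ℕ∞) (i : Fin k) : (meet m D i : ℕ∞) ≤ D i := by
  rcases meet_cases m D i with ⟨h, _⟩ | ⟨t, h, h'⟩
  · rw [h]; exact le_top
  · rw [h, h']; exact Nat.cast_le.2 (min_le_right _ _)

theorem meet_mono {m n : Fin k → ℕ} (h : m ≤ n) (D : Fin k → ℕ∞) : meet m D ≤ meet n D := fun i => by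
  change meet m D i ≤ meet n D i
  have : m i ≤ n i := h i
  rcases meet_cases m D i with ⟨h1, h2⟩ | ⟨t, h1, h2⟩ <;>
  rcases meet_cases n D i with ⟨h3, h4⟩ | ⟨t', h3, h4⟩
  · omega
  · rw [h1] at h3; exact absurd h3 (ENat.top_ne_natCast _)
  · rw [h1] at h3; exact absurd h3 (ENat.natCast_ne_top _)
  · rw [h1, Nat.cast_inj] at h3; omega

variable (Λ : KGraph.{u} k)

/-- The set `V_Λ` of pairs `(x; m)`. -/
structure PreVert where
  x : Λ.BoundaryPath
  m : Fin k → ℕ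

/-- The set `P_Λ` of pairs `(x; (m, n))` with `m ≤ n`. -/
structure PrePath where
  x : Λ.BoundaryPath
  m : Fin k → ℕ
  n : Fin k → ℕ
  le : m ≤ n

variable {Λ}

/-- The vertex `x(m ∧ d(x))`. -/
def PreVert.base (a : Λ.PreVert) : Λ.Vert :=
  a.x.vert (meet a.m a.x.deg) (meet_le_right _ _)

/-- The path `x(m ∧ d(x), n ∧ d(x))`. -/
def PrePath.base (a : Λ.PrePath) : Λ.Path :=
  a.x.seg (meet a.m a.x.deg) (meet a.n a.x.deg) (meet_mono a.le _) (meet_le_right _ _)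

variable (Λ)

/-- The equivalence relation `≈` on `V_Λ`. -/
def vertSetoid : Setoid Λ.PreVert where
  r a b := a.base = b.base ∧ a.m - meet a.m a.x.deg = b.m - meet b.m b.x.deg
  iseqv := ⟨fun _ => ⟨rfl, rfl⟩, fun h => ⟨h.1.symm, h.2.symm⟩,
    fun h h' => ⟨h.1.trans h'.1, h.2.trans h'.2⟩⟩

/-- The equivalence relation `∼` on `P_Λ`. -/
def pathSetoid : Setoid Λ.PrePath where
  r a b := a.base = b.base ∧ a.m - meet a.m a.x.deg = b.m - meet b.m b.x.deg ∧
    a.n - a.m = b.n - b.m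
  iseqv := ⟨fun _ => ⟨rfl, rfl, rfl⟩, fun h => ⟨h.1.symm, h.2.1.symm, h.2.2.symm⟩,
    fun h h' => ⟨h.1.trans h'.1, h.2.1.trans h'.2.1, h.2.2.trans h'.2.2⟩⟩

/-- The vertices `V_Λ / ≈` of the desourcification. -/
def TVert : Type u := Quotient Λ.vertSetoid

/-- The paths `P_Λ / ∼` of the desourcification. -/
def TPath : Type u := Quotient Λ.pathSetoid

variable {Λ}

/-- The vertex `[x; m]`. -/
def TVert.mk (x : Λ.BoundaryPath) (m : Fin k → ℕ) : Λ.TVert := Quotient.mk Λ.vertSetoid ⟨x, m⟩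

/-- The path `[x; (m, n)]`. -/
def TPath.mk (x : Λ.BoundaryPath) (m n : Fin k → ℕ) (h : m ≤ n) : Λ.TPath :=
  Quotient.mk Λ.pathSetoid ⟨x, m, n, h⟩

def TVert.key : Λ.TVert → Λ.Vert × (Fin k → ℕ) :=
  Quotient.lift (fun a => (a.base, a.m - meet a.m a.x.deg)) fun _ _ h => Prod.ext h.1 h.2

def TPath.key : Λ.TPath → Λ.Path × (Fin k → ℕ) × (Fin k → ℕ) :=
  Quotient.lift (fun a => (a.base, a.m - meet a.m a.x.deg, a.n - a.m))
    fun _ _ h => Prod.ext h.1 (Prod.ext h.2.1 h.2.2)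

theorem TVert.key_injective : Function.Injective (TVert.key (Λ := Λ)) := by
  rintro ⟨a⟩ ⟨b⟩ h
  exact Quotient.sound ⟨congrArg Prod.fst h, congrArg Prod.snd h⟩

theorem TPath.key_injective : Function.Injective (TPath.key (Λ := Λ)) := by
  rintro ⟨a⟩ ⟨b⟩ h
  exact Quotient.sound ⟨congrArg Prod.fst h, congrArg (fun t => t.2.1) h, congrArg (fun t => t.2.2) h⟩

theorem PrePath.d_base (a : Λ.PrePath) : Λ.d a.base = meet a.n a.x.deg - meet a.m a.x.deg :=
  a.x.d_seg _ _ _ _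

/-- `r([x; (m, n)]) = [x; m]`. -/
def TPath.r : Λ.TPath → Λ.TVert :=
  Quotient.lift (fun a => TVert.mk a.x a.m) fun a b h => Quotient.sound ⟨by
    have := congrArg Λ.r h.1
    rw [PrePath.base, PrePath.base, BoundaryPath.r_seg, BoundaryPath.r_seg] at this
    exact this, h.2.1⟩

/-- `s([x; (m, n)]) = [x; n]`. -/
def TPath.s : Λ.TPath → Λ.TVert :=
  Quotient.lift (fun a => TVert.mk a.x a.n) fun a b h => Quotient.sound ⟨by
    have := congrArg Λ.s h.1
    rw [PrePath.base, PrePath.base, BoundaryPath.s_seg, BoundaryPath.s_seg] at this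
    exact this, by
    have h1 := congrArg Λ.d h.1
    rw [a.d_base, b.d_base] at h1
    funext i
    have h1 := congrFun h1 i
    have h2 := congrFun h.2.1 i
    have h3 := congrFun h.2.2 i
    have a1 : meet a.m a.x.deg i ≤ meet a.n a.x.deg i := meet_mono a.le a.x.deg i
    have b1 : meet b.m b.x.deg i ≤ meet b.n b.x.deg i := meet_mono b.le b.x.deg i
    have a2 : meet a.m a.x.deg i ≤ a.m i := meet_le a.m a.x.deg i
    have b2 : meet b.m b.x.deg i ≤ b.m i := meet_le b.m b.x.deg i
    have a3 : meet a.n a.x.deg i ≤ a.n i := meet_le a.n a.x.deg i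
    have b3 : meet b.n b.x.deg i ≤ b.n i := meet_le b.n b.x.deg i
    have a4 : a.m i ≤ a.n i := a.le i
    have b4 : b.m i ≤ b.n i := b.le i
    simp only [Pi.sub_apply] at h1 h2 h3 ⊢
    omega⟩

/-- `d([x; (m, n)]) = n - m`. -/
def TPath.d : Λ.TPath → (Fin k → ℕ) :=
  Quotient.lift (fun a => a.n - a.m) fun _ _ h => h.2.2

/-- `id([x; m]) = [x; (m, m)]`. -/
def TVert.one : Λ.TVert → Λ.TPath :=
  Quotient.lift (fun a => TPath.mk a.x a.m a.m le_rfl) fun a b h => Quotient.sound ⟨by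
    have := congrArg Λ.one h.1
    simpa only [PrePath.base, PreVert.base, BoundaryPath.seg_self] using this, h.2, by simp⟩

/-- `(x; (m, n)) ∘ (y; (p, q)) = (x(0, n ∧ d(x)) σ^{p ∧ d(y)}(y); (m, n + q - p))`,
on representatives. -/
def PrePath.comp [Λ.LocallyConvex] (a b : Λ.PrePath)
    (h : (⟨a.x, a.n⟩ : Λ.PreVert).base = (⟨b.x, b.m⟩ : Λ.PreVert).base) : Λ.PrePath where
  x := BoundaryPath.concat (a.x.seg 0 (meet a.n a.x.deg) (fun _ => Nat.zero_le _) (meet_le_right _ _))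
    b.x (meet b.m b.x.deg) (meet_le_right _ _) (by rw [BoundaryPath.s_seg]; exact h)
  m := a.m
  n := a.n + b.n - b.m
  le := fun i => by
    have h1 : a.m i ≤ a.n i := a.le i
    have h2 : b.m i ≤ b.n i := b.le i
    simp only [Pi.add_apply, Pi.sub_apply]; omega

theorem PrePath.comp_spec [Λ.LocallyConvex] (a b : Λ.PrePath)
    (h : (⟨a.x, a.n⟩ : Λ.PreVert).base = (⟨b.x, b.m⟩ : Λ.PreVert).base)
    (h' : a.n - meet a.n a.x.deg = b.m - meet b.m b.x.deg) :
    meet (a.comp b h).m (a.comp b h).x.deg = meet a.m a.x.deg ∧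
    meet (a.comp b h).n (a.comp b h).x.deg =
      meet a.n a.x.deg + (meet b.n b.x.deg - meet b.m b.x.deg) ∧
    Λ.IsComp a.base b.base (a.comp b h).base := by
  obtain ⟨hdeg, h0, hseg⟩ :
      (∀ i, (a.comp b h).x.deg i + meet b.m b.x.deg i = meet a.n a.x.deg i + b.x.deg i) ∧
      (∀ h', (a.comp b h).x.seg 0 (meet a.n a.x.deg) (fun _ => Nat.zero_le _) h' =
        a.x.seg 0 (meet a.n a.x.deg) (fun _ => Nat.zero_le _) (meet_le_right _ _)) ∧
      ∀ h', (a.comp b h).x.seg (meet a.n a.x.deg)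
          (meet a.n a.x.deg + (meet b.n b.x.deg - meet b.m b.x.deg)) le_self_add h' =
        b.x.seg (meet b.m b.x.deg) (meet b.n b.x.deg) (meet_mono b.le _) (meet_le_right _ _) :=
    BoundaryPath.concat_spec
    (a.x.seg 0 (meet a.n a.x.deg) (fun _ => Nat.zero_le _) (meet_le_right _ _))
    b.x (meet b.m b.x.deg) (meet_le_right _ _) (by rw [BoundaryPath.s_seg]; exact h)
    (meet a.n a.x.deg) (by rw [BoundaryPath.d_seg]; simp) (meet b.n b.x.deg) (meet_mono b.le _)
    (meet_le_right _ _)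
  have hm : (a.comp b h).m = a.m := rfl
  have hn : (a.comp b h).n = a.n + b.n - b.m := rfl
  generalize (a.comp b h) = c at *
  have key : ∀ i, meet c.m c.x.deg i = meet a.m a.x.deg i ∧ meet c.n c.x.deg i =
      meet a.n a.x.deg i + (meet b.n b.x.deg i - meet b.m b.x.deg i) := by
    intro i
    have e1 := hdeg i
    have e2 := congrFun h' i
    have e3 : a.m i ≤ a.n i := a.le i
    have e4 : b.m i ≤ b.n i := b.le i
    have e5 := congrFun hm i
    have e6 := congrFun hn i
    simp only [Pi.sub_apply, Pi.add_apply] at e2 e5 e6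
    have x1 := meet_cases a.m a.x.deg i
    have x2 := meet_cases a.n a.x.deg i
    have y1 := meet_cases b.m b.x.deg i
    have y2 := meet_cases b.n b.x.deg i
    have z1 := meet_cases c.m c.x.deg i
    have z2 := meet_cases c.n c.x.deg i
    generalize meet a.m a.x.deg i = am at *
    generalize meet a.n a.x.deg i = an at *
    generalize meet b.m b.x.deg i = bm at *
    generalize meet b.n b.x.deg i = bn at *
    generalize meet c.m c.x.deg i = cm at *
    generalize meet c.n c.x.deg i = cn at *
    generalize a.x.deg i = dx at *
    generalize b.x.deg i = dy at *
    generalize c.x.deg i = dz at *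
    induction dx using ENat.recTopCoe <;> induction dy using ENat.recTopCoe <;>
      induction dz using ENat.recTopCoe <;>
      simp at * <;> norm_cast at * <;> omega
  have key1 : meet c.m c.x.deg = meet a.m a.x.deg := funext fun i => (key i).1
  have key2 : meet c.n c.x.deg =
    meet a.n a.x.deg + (meet b.n b.x.deg - meet b.m b.x.deg) := funext fun i => (key i).2
  refine ⟨key1, key2, ?_⟩
  have hQ : ∀ i, ((meet a.n a.x.deg + (meet b.n b.x.deg - meet b.m b.x.deg)) i : ℕ∞) ≤ c.x.deg i := by
    rw [← key2]; exact meet_le_right _ _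
  have hA : ∀ i, (meet a.n a.x.deg i : ℕ∞) ≤ c.x.deg i := fun i =>
    (Nat.cast_le.2 (le_self_add : meet a.n a.x.deg i ≤ _)).trans (hQ i)
  have hcb : c.base = c.x.seg (meet a.m a.x.deg)
      (meet a.n a.x.deg + (meet b.n b.x.deg - meet b.m b.x.deg))
      ((meet_mono a.le _).trans le_self_add) hQ := c.x.seg_congr key1 key2 _ _
  have s1 := c.x.seg_isComp _ _ _ (meet_mono a.le a.x.deg)
    (le_self_add : _ ≤ meet a.n a.x.deg + (meet b.n b.x.deg - meet b.m b.x.deg)) hQ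
  rw [hseg hQ] at s1
  have s2 := c.x.seg_isComp 0 _ _ (fun _ => Nat.zero_le _) (meet_mono a.le a.x.deg) hA
  have s3 := a.x.seg_isComp 0 _ _ (fun _ => Nat.zero_le _) (meet_mono a.le a.x.deg)
    (meet_le_right _ _)
  rw [h0 hA] at s2
  have s4 := (s2.cancel s3 (by rw [BoundaryPath.d_seg, BoundaryPath.d_seg])).2
  rw [s4, ← hcb] at s1
  exact s1

theorem TPath.exists_comp [Λ.LocallyConvex] (a b : Λ.TPath) (h : a.s = b.r) :
    (⟨a.out.x, a.out.n⟩ : Λ.PreVert).base = (⟨b.out.x, b.out.m⟩ : Λ.PreVert).base ∧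
    a.out.n - meet a.out.n a.out.x.deg = b.out.m - meet b.out.m b.out.x.deg := by
  have ha : Quotient.mk Λ.pathSetoid a.out = a := Quotient.out_eq a
  have hb : Quotient.mk Λ.pathSetoid b.out = b := Quotient.out_eq b
  rw [← ha, ← hb] at h
  exact Quotient.exact h

/-- Composition in the desourcification, given on all representatives by `PrePath.comp`
(see `TPath.comp_mk`). -/
def TPath.comp [Λ.LocallyConvex] (a b : Λ.TPath) (h : a.s = b.r) : Λ.TPath :=
  Quotient.mk Λ.pathSetoid (a.out.comp b.out (TPath.exists_comp a b h).1)

theorem PrePath.key_comp [Λ.LocallyConvex] (a b : Λ.PrePath)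
    (h : (⟨a.x, a.n⟩ : Λ.PreVert).base = (⟨b.x, b.m⟩ : Λ.PreVert).base)
    (h' : a.n - meet a.n a.x.deg = b.m - meet b.m b.x.deg) :
    Λ.IsComp (TPath.key (Quotient.mk _ a)).1 (TPath.key (Quotient.mk _ b)).1
      (TPath.key (Quotient.mk _ (a.comp b h))).1 ∧
    (TPath.key (Quotient.mk _ (a.comp b h))).2 = ((TPath.key (Quotient.mk _ a)).2.1,
      (TPath.key (Quotient.mk _ a)).2.2 + (TPath.key (Quotient.mk _ b)).2.2) ∧
    Λ.d (TPath.key (Quotient.mk _ a)).1 = (TPath.key (Quotient.mk _ a)).2.2 ⊓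
      Λ.d (TPath.key (Quotient.mk _ (a.comp b h))).1 := by
  obtain ⟨h1, h2, h3⟩ := a.comp_spec b h h'
  refine ⟨h3, ?_, ?_⟩
  · change ((a.comp b h).m - meet (a.comp b h).m (a.comp b h).x.deg,
      (a.comp b h).n - (a.comp b h).m) = (a.m - meet a.m a.x.deg, (a.n - a.m) + (b.n - b.m))
    rw [h1]
    change (a.m - meet a.m a.x.deg, a.n + b.n - b.m - a.m) = _
    refine Prod.ext rfl (funext fun i => ?_)
    have e3 : a.m i ≤ a.n i := a.le i
    have e4 : b.m i ≤ b.n i := b.le i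
    simp only [Pi.sub_apply, Pi.add_apply]; omega
  · change Λ.d a.base = (a.n - a.m) ⊓ Λ.d (a.comp b h).base
    rw [PrePath.d_base, PrePath.d_base, h1, h2]
    funext i
    have e2 := congrFun h' i
    have e3 : a.m i ≤ a.n i := a.le i
    have e4 : b.m i ≤ b.n i := b.le i
    simp only [Pi.sub_apply, Pi.add_apply, Pi.inf_apply] at e2 ⊢
    have m1 : meet a.m a.x.deg i ≤ meet a.n a.x.deg i := meet_mono a.le a.x.deg i
    have m2 : meet b.m b.x.deg i ≤ meet b.n b.x.deg i := meet_mono b.le b.x.deg i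
    rcases meet_cases a.m a.x.deg i with ⟨x1, x1'⟩ | ⟨t, x1, x1'⟩ <;>
    rcases meet_cases a.n a.x.deg i with ⟨x2, x2'⟩ | ⟨t', x2, x2'⟩ <;>
    rcases meet_cases b.m b.x.deg i with ⟨y1, y1'⟩ | ⟨u, y1, y1'⟩ <;>
    rcases meet_cases b.n b.x.deg i with ⟨y2, y2'⟩ | ⟨u', y2, y2'⟩ <;>
    rw [x1] at x2 <;> rw [y1] at y2 <;> simp at x2 y2 <;> omega

theorem TPath.key_comp [Λ.LocallyConvex] (a b : Λ.TPath) (h : a.s = b.r) :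
    Λ.IsComp a.key.1 b.key.1 (a.comp b h).key.1 ∧
    (a.comp b h).key.2 = (a.key.2.1, a.key.2.2 + b.key.2.2) ∧
    Λ.d a.key.1 = a.key.2.2 ⊓ Λ.d (a.comp b h).key.1 := by
  have := a.out.key_comp b.out (TPath.exists_comp a b h).1 (TPath.exists_comp a b h).2
  have ha : Quotient.mk Λ.pathSetoid a.out = a := Quotient.out_eq a
  have hb : Quotient.mk Λ.pathSetoid b.out = b := Quotient.out_eq b
  rwa [ha, hb] at this

theorem TPath.key_ext {a b : Λ.TPath} (h : a.key.1 = b.key.1) (h' : a.key.2 = b.key.2) : a = b :=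
  TPath.key_injective (Prod.ext h h')

/-- The composition formula
`[x; (m, n)] ∘ [y; (p, q)] = [x(0, n ∧ d(x)) σ^{p ∧ d(y)}(y); (m, n + q - p)]`. -/
theorem TPath.comp_mk [Λ.LocallyConvex] (a b : Λ.PrePath)
    (h : (⟨a.x, a.n⟩ : Λ.PreVert).base = (⟨b.x, b.m⟩ : Λ.PreVert).base)
    (h' : a.n - meet a.n a.x.deg = b.m - meet b.m b.x.deg) :
    TPath.comp (Quotient.mk _ a) (Quotient.mk _ b) (Quotient.sound ⟨h, h'⟩) =
      Quotient.mk _ (a.comp b h) := by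
  obtain ⟨h1, h2, -⟩ := TPath.key_comp (Quotient.mk _ a) (Quotient.mk _ b) (Quotient.sound ⟨h, h'⟩)
  obtain ⟨h3, h4, -⟩ := a.key_comp b h h'
  exact TPath.key_ext (h1.unique h3) (h2.trans h4.symm)

theorem TPath.key_r (a : Λ.TPath) : a.r.key = (Λ.r a.key.1, a.key.2.1) := by
  obtain ⟨a⟩ := a
  exact Prod.ext (a.x.r_seg _ _ (meet_mono a.le _) (meet_le_right _ _)).symm rfl

theorem TPath.key_s (a : Λ.TPath) :
    a.s.key = (Λ.s a.key.1, a.key.2.1 + a.key.2.2 - Λ.d a.key.1) := by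
  obtain ⟨a⟩ := a
  refine Prod.ext (a.x.s_seg _ _ (meet_mono a.le _) (meet_le_right _ _)).symm ?_
  change a.n - meet a.n a.x.deg = a.m - meet a.m a.x.deg + (a.n - a.m) - Λ.d a.base
  rw [PrePath.d_base]
  funext i
  have a1 : meet a.m a.x.deg i ≤ meet a.n a.x.deg i := meet_mono a.le a.x.deg i
  have a2 : meet a.m a.x.deg i ≤ a.m i := meet_le a.m a.x.deg i
  have a3 : meet a.n a.x.deg i ≤ a.n i := meet_le a.n a.x.deg i
  have a4 : a.m i ≤ a.n i := a.le i
  simp only [Pi.sub_apply, Pi.add_apply]; omega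

theorem TPath.key_d (a : Λ.TPath) : a.d = a.key.2.2 := by
  obtain ⟨a⟩ := a; rfl

theorem TPath.d_key_le (a : Λ.TPath) : Λ.d a.key.1 ≤ a.key.2.2 := by
  obtain ⟨a⟩ := a
  change Λ.d a.base ≤ a.n - a.m
  rw [PrePath.d_base]
  intro i
  have a4 : a.m i ≤ a.n i := a.le i
  simp only [Pi.sub_apply]
  rcases meet_cases a.m a.x.deg i with ⟨x1, x1'⟩ | ⟨t, x1, x1'⟩ <;>
  rcases meet_cases a.n a.x.deg i with ⟨x2, x2'⟩ | ⟨t', x2, x2'⟩ <;>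
  rw [x1] at x2 <;> simp at x2 <;> omega

theorem TVert.key_one (v : Λ.TVert) : v.one.key = (Λ.one v.key.1, v.key.2, 0) := by
  obtain ⟨v⟩ := v
  refine Prod.ext (v.x.seg_self _ _) (Prod.ext rfl ?_)
  exact tsub_self v.m

theorem TVert.r_one (v : Λ.TVert) : v.one.r = v := by obtain ⟨v⟩ := v; rfl
theorem TVert.s_one (v : Λ.TVert) : v.one.s = v := by obtain ⟨v⟩ := v; rfl

theorem TPath.r_comp [Λ.LocallyConvex] (a b : Λ.TPath) (h : a.s = b.r) : (a.comp b h).r = a.r := by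
  obtain ⟨h1, h2, -⟩ := a.key_comp b h
  apply TVert.key_injective
  rw [TPath.key_r, TPath.key_r, h1.r, h2]

theorem TPath.s_comp [Λ.LocallyConvex] (a b : Λ.TPath) (h : a.s = b.r) : (a.comp b h).s = b.s := by
  obtain ⟨h1, h2, -⟩ := a.key_comp b h
  apply TVert.key_injective
  have h3 := congrArg TVert.key h
  rw [TPath.key_s, TPath.key_r] at h3
  rw [TPath.key_s, TPath.key_s, h1.s, h2, h1.deg]
  refine Prod.ext rfl (funext fun i => ?_)
  have h4 := congrFun (congrArg Prod.snd h3) i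
  have h5 : Λ.d a.key.1 i ≤ a.key.2.2 i := a.d_key_le i
  simp only [Pi.sub_apply, Pi.add_apply] at h4 ⊢; omega

theorem TPath.factor [Λ.LocallyConvex] (f : Λ.TPath) (m n : Fin k → ℕ) (hf : f.d = m + n) :
    ∃! p : Λ.TPath × Λ.TPath, p.1.d = m ∧ p.2.d = n ∧ ∃ h : p.1.s = p.2.r, f = p.1.comp p.2 h := by
  obtain ⟨p, hp⟩ : ∃ p : Λ.TPath × Λ.TPath, p.1.d = m ∧ p.2.d = n ∧
      ∃ h : p.1.s = p.2.r, f = p.1.comp p.2 h := by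
    obtain ⟨a⟩ := f
    change a.n - a.m = m + n at hf
    have hle : a.m + m ≤ a.n := fun i => by
      have h1 := congrFun hf i
      have h2 : a.m i ≤ a.n i := a.le i
      simp only [Pi.sub_apply, Pi.add_apply] at h1 ⊢; omega
    have hn : a.n - (a.m + m) = n := by
      rw [← tsub_tsub, hf]; simp
    refine ⟨(TPath.mk a.x a.m (a.m + m) le_self_add, TPath.mk a.x (a.m + m) a.n hle), ?_, hn, rfl, ?_⟩
    · change a.m + m - a.m = m
      simp
    · obtain ⟨h1, h2, -⟩ := TPath.key_comp (TPath.mk a.x a.m (a.m + m) le_self_add)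
        (TPath.mk a.x (a.m + m) a.n hle) rfl
      refine TPath.key_ext ?_ ?_
      · exact (a.x.seg_isComp _ _ _ (meet_mono le_self_add _) (meet_mono hle _)
          (meet_le_right _ _)).unique h1
      · rw [h2]
        refine Prod.ext rfl ?_
        change a.n - a.m = a.m + m - a.m + (a.n - (a.m + m))
        rw [hn, hf]; simp
  refine ⟨p, hp, ?_⟩
  rintro ⟨c, d⟩ ⟨hc, hd, h, hcd⟩
  obtain ⟨a, b⟩ := p
  obtain ⟨ha, hb, h', hab⟩ := hp
  dsimp only at *
  obtain ⟨x1, x2, x3⟩ := c.key_comp d h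
  obtain ⟨y1, y2, y3⟩ := a.key_comp b h'
  rw [← hcd] at x1 x2 x3
  rw [← hab] at y1 y2 y3
  rw [TPath.key_d] at hc hd ha hb
  rw [hc] at x3
  rw [ha] at y3
  obtain ⟨z1, z2⟩ := x1.cancel y1 (x3.trans y3.symm)
  have z3 : c.key.2.1 = a.key.2.1 := by
    have e1 := congrArg Prod.fst x2
    have e2 := congrArg Prod.fst y2
    exact e1.symm.trans e2
  have hca : c = a := TPath.key_ext z1 (Prod.ext z3 (hc.trans ha.symm))
  subst hca
  have hdb : d = b := by
    refine TPath.key_ext z2 (Prod.ext ?_ (hd.trans hb.symm))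
    have e := congrArg TVert.key (h.symm.trans h')
    rw [TPath.key_r, TPath.key_r] at e
    exact congrArg Prod.snd e
  rw [hdb]

/-- The desourcification `Λ̃` of a locally convex `k`-graph `Λ`. -/
def desourcification (Λ : KGraph.{u} k) [Λ.LocallyConvex] : KGraph.{u} k where
  Vert := Λ.TVert
  Path := Λ.TPath
  r := TPath.r
  s := TPath.s
  one := TVert.one
  comp := TPath.comp
  d := TPath.d
  countable := by
    have := Λ.countable
    exact TPath.key_injective.countable
  r_one := TVert.r_one
  s_one := TVert.s_one
  r_comp := TPath.r_comp
  s_comp := TPath.s_comp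
  one_comp f := by
    obtain ⟨h1, h2, -⟩ := TPath.key_comp f.r.one f (TVert.s_one _)
    rw [TVert.key_one, TPath.key_r] at h1 h2
    exact TPath.key_ext (h1.unique (one_isComp _)) (h2.trans (by simp))
  comp_one f := by
    obtain ⟨h1, h2, -⟩ := TPath.key_comp f f.s.one (TVert.r_one _).symm
    rw [TVert.key_one, TPath.key_s] at h1 h2
    exact TPath.key_ext (h1.unique (isComp_one _)) (h2.trans (by simp))
  assoc f g l h h' := by
    obtain ⟨a1, a2, -⟩ := TPath.key_comp f g h
    obtain ⟨b1, b2, -⟩ := TPath.key_comp (f.comp g h) l ((TPath.s_comp f g h).trans h')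
    obtain ⟨c1, c2, -⟩ := TPath.key_comp g l h'
    obtain ⟨d1, d2, -⟩ := TPath.key_comp f (g.comp l h') (h.trans (TPath.r_comp g l h').symm)
    refine TPath.key_ext ((a1.assoc b1 c1).unique d1) ?_
    rw [b2, d2, a2, c2]
    simp [add_assoc]
  d_one v := by rw [TPath.key_d, TVert.key_one]
  d_comp f g h := by
    rw [TPath.key_d, TPath.key_d, TPath.key_d, (TPath.key_comp f g h).2.1]
  factor := TPath.factor

theorem desourcification_noSources (Λ : KGraph.{u} k) [Λ.LocallyConvex] :
    Λ.desourcification.NoSources := by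
  rintro ⟨v⟩ n
  refine ⟨TPath.mk v.x v.m (v.m + n) le_self_add, rfl, ?_⟩
  change v.m + n - v.m = n
  simp

instance (Λ : KGraph.{u} k) [Λ.LocallyConvex] : Λ.desourcification.LocallyConvex :=
  Λ.desourcification_noSources.locallyConvex

instance (Λ : KGraph.{u} k) [Λ.LocallyConvex] [Λ.RowFinite] : Λ.desourcification.RowFinite where
  finite v n := by
    have hfin : (⋃ m ∈ Set.Iic n, Λ.pathsOf (TVert.key v).1 m).Finite :=
      (Set.finite_Iic n).biUnion fun m _ => RowFinite.finite _ m
    refine ((hfin.prod (Set.finite_singleton ((TVert.key v).2, n))).preimage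
      TPath.key_injective.injOn).subset ?_
    rintro f ⟨h1, h2⟩
    change TPath.r f = v at h1
    change TPath.d f = n at h2
    rw [TPath.key_d] at h2
    have h3 := TPath.key_r f
    rw [h1] at h3
    refine ⟨Set.mem_biUnion (x := Λ.d (TPath.key f).1) ?_ ⟨?_, rfl⟩, ?_⟩
    · rw [← h2]; exact TPath.d_key_le f
    · rw [h3]
    · rw [h3, ← h2]; rfl

/-- A chosen boundary path with range `v`. -/
def someBoundaryPath (Λ : KGraph.{u} k) [Λ.LocallyConvex] (v : Λ.Vert) : Λ.BoundaryPath :=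
  (exists_boundaryPath Λ v).choose

theorem someBoundaryPath_range (Λ : KGraph.{u} k) [Λ.LocallyConvex] (v : Λ.Vert) :
    (Λ.someBoundaryPath v).range = v :=
  (exists_boundaryPath Λ v).choose_spec

/-- `ι(v) = [x; 0]` on vertices, where `x ∈ vΛ^{≤∞}`. -/
def iotaVert (Λ : KGraph.{u} k) [Λ.LocallyConvex] (v : Λ.Vert) : Λ.desourcification.Vert :=
  TVert.mk (Λ.someBoundaryPath v) 0

/-- The class `[λx; (0, d(λ))]` for a boundary path `x` with range `s(λ)`. -/
def iotaPathOf [Λ.LocallyConvex] (f : Λ.Path) (x : Λ.BoundaryPath) (hx : x.range = Λ.s f) :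
    Λ.desourcification.Path :=
  TPath.mk (BoundaryPath.concat f x 0 (fun _ => by simp) hx.symm) 0 (Λ.d f) fun _ => Nat.zero_le _

/-- `ι(λ) = [λx; (0, d(λ))]` on paths, where `x ∈ s(λ)Λ^{≤∞}` (see `iotaPath_eq`). -/
def iotaPath (Λ : KGraph.{u} k) [Λ.LocallyConvex] (f : Λ.Path) : Λ.desourcification.Path :=
  iotaPathOf f (Λ.someBoundaryPath (Λ.s f)) (Λ.someBoundaryPath_range _)

theorem iotaVert_eq [Λ.LocallyConvex] (v : Λ.Vert) (x : Λ.BoundaryPath) (hx : x.range = v) :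
    Λ.iotaVert v = TVert.mk x 0 := by
  refine Quotient.sound ⟨?_, by simp⟩
  have hm : ∀ D : Fin k → ℕ∞, meet 0 D = 0 := fun D => by funext i; simp [meet]
  rw [PreVert.base, PreVert.base, BoundaryPath.vert_congr _ (hm _), BoundaryPath.vert_congr _ (hm _)]
  exact (Λ.someBoundaryPath_range v).trans hx.symm

theorem iotaPathOf_key [Λ.LocallyConvex] (f : Λ.Path) (x : Λ.BoundaryPath) (hx : x.range = Λ.s f) :
    TPath.key (iotaPathOf f x hx) = (f, 0, Λ.d f) := by
  obtain ⟨h1, h2, -⟩ := BoundaryPath.concat_spec f x 0 (fun _ => by simp) hx.symm (Λ.d f) rfl 0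
    le_rfl (fun _ => by simp)
  have hm : meet 0 (BoundaryPath.concat f x 0 (fun _ => by simp) hx.symm).deg = 0 := by
    funext i; simp [meet]
  have hle : ∀ i, (Λ.d f i : ℕ∞) ≤ (BoundaryPath.concat f x 0 (fun _ => by simp) hx.symm).deg i := by
    intro i
    have := h1 i
    simp only [Pi.zero_apply, Nat.cast_zero, add_zero] at this
    rw [this]; exact le_self_add
  have hn : meet (Λ.d f) (BoundaryPath.concat f x 0 (fun _ => by simp) hx.symm).deg = Λ.d f := by
    funext i
    simp only [meet]
    rw [min_eq_left (hle i)]; rfl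
  refine Prod.ext ?_ (Prod.ext ?_ ?_)
  · exact (BoundaryPath.seg_congr _ hm hn (meet_mono (fun _ => Nat.zero_le _) _)
      (meet_le_right _ _)).trans (h2 hle)
  · change 0 - _ = 0
    simp
  · change Λ.d f - 0 = Λ.d f
    simp

/-- `ι(λ) = [λx; (0, d(λ))]` for every boundary path `x` with range `s(λ)`. -/
theorem iotaPath_eq [Λ.LocallyConvex] (f : Λ.Path) (x : Λ.BoundaryPath) (hx : x.range = Λ.s f) :
    Λ.iotaPath f = iotaPathOf f x hx :=
  TPath.key_injective ((iotaPathOf_key _ _ _).trans (iotaPathOf_key _ _ _).symm)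

/-! ### Kumjian-Pask algebras -/

/-- The generators of the Kumjian-Pask algebra: the vertices `v`, the paths `λ` and the ghost
paths `λ^*`. Vertices are identified with the (ghost) paths of degree zero by the relations
`KPRel.path_one` and `KPRel.ghost_one`. -/
inductive Gen (Λ : KGraph.{u} k) : Type u
  | vert : Λ.Vert → Gen Λ
  | path : Λ.Path → Gen Λ
  | ghost : Λ.Path → Gen Λ

/-- The free (non-unital, associative) `R`-algebra on the generators: formal `R`-linear combinations
of nonempty words. -/
abbrev FreeAlg (R : Type v) [CommRing R] (Λ : KGraph.{u} k) : Type (max u v) :=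
  MonoidAlgebra R (FreeSemigroup Λ.Gen)

section KP
variable (R : Type v) [CommRing R] (Λ : KGraph.{u} k)

variable {Λ} in
/-- A generator, as an element of the free algebra. -/
def gen (x : Λ.Gen) : FreeAlg R Λ := MonoidAlgebra.single (FreeSemigroup.of x) 1

variable {Λ} in
/-- The generator `p_v`. -/
def genP (v : Λ.Vert) : FreeAlg R Λ := gen R (Gen.vert v)

variable {Λ} in
/-- The generator `s_λ`. -/
def genS (f : Λ.Path) : FreeAlg R Λ := gen R (Gen.path f)

variable {Λ} in
/-- The generator `s_{λ^*}`. -/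
def genT (f : Λ.Path) : FreeAlg R Λ := gen R (Gen.ghost f)

/-- The Kumjian-Pask relations, closed under the operations of an `R`-algebra. -/
inductive KPRel [Λ.RowFinite] : FreeAlg R Λ → FreeAlg R Λ → Prop
  | path_one (v : Λ.Vert) : KPRel (genS R (Λ.one v)) (genP R v)
  | ghost_one (v : Λ.Vert) : KPRel (genT R (Λ.one v)) (genP R v)
  | kp1_self (v : Λ.Vert) : KPRel (genP R v * genP R v) (genP R v)
  | kp1_ne (v w : Λ.Vert) : v ≠ w → KPRel (genP R v * genP R w) 0
  | kp2_path (f g : Λ.Path) (h : Λ.s f = Λ.r g) : KPRel (genS R f * genS R g) (genS R (Λ.comp f g h))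
  | kp2_ghost (f g : Λ.Path) (h : Λ.s f = Λ.r g) : KPRel (genT R g * genT R f) (genT R (Λ.comp f g h))
  | kp2_range_path (f : Λ.Path) : KPRel (genP R (Λ.r f) * genS R f) (genS R f)
  | kp2_path_source (f : Λ.Path) : KPRel (genS R f * genP R (Λ.s f)) (genS R f)
  | kp2_source_ghost (f : Λ.Path) : KPRel (genP R (Λ.s f) * genT R f) (genT R f)
  | kp2_ghost_range (f : Λ.Path) : KPRel (genT R f * genP R (Λ.r f)) (genT R f)
  | kp3_self (n : Fin k → ℕ) (f : Λ.Path) : n ≠ 0 → f ∈ Λ.maxPaths n → KPRel (genT R f * genS R f) (genP R (Λ.s f))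
  | kp3_ne (n : Fin k → ℕ) (f g : Λ.Path) : n ≠ 0 → f ∈ Λ.maxPaths n → g ∈ Λ.maxPaths n → f ≠ g →
      KPRel (genT R f * genS R g) 0
  | kp4 (v : Λ.Vert) (n : Fin k → ℕ) : n ≠ 0 →
      KPRel (genP R v) (∑ f ∈ (Λ.maxPathsOf_finite v n).toFinset, genS R f * genT R f)
  | smul (c : R) {a b : FreeAlg R Λ} : KPRel a b → KPRel (c • a) (c • b)
  | add_right {a b : FreeAlg R Λ} (c : FreeAlg R Λ) : KPRel a b → KPRel (a + c) (b + c)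
  | mul_left (a : FreeAlg R Λ) {b c : FreeAlg R Λ} : KPRel b c → KPRel (a * b) (a * c)
  | mul_right {a b : FreeAlg R Λ} (c : FreeAlg R Λ) : KPRel a b → KPRel (a * c) (b * c)

/-- The Kumjian-Pask algebra `KP_R(Λ)` of a row-finite `k`-graph: the (possibly non-unital)
`R`-algebra with generators `Gen Λ` subject to the Kumjian-Pask relations. -/
def KP [Λ.RowFinite] : Type (max u v) := Quot (KPRel R Λ)

variable {R Λ} [Λ.RowFinite]

theorem KPRel.add_left (a : FreeAlg R Λ) {b c : FreeAlg R Λ} (h : KPRel R Λ b c) :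
    KPRel R Λ (a + b) (a + c) := by
  rw [add_comm a b, add_comm a c]; exact h.add_right a

theorem KPRel.neg {a b : FreeAlg R Λ} (h : KPRel R Λ a b) : KPRel R Λ (-a) (-b) := by
  simpa only [neg_one_smul] using h.smul (-1)

namespace KP

instance : Zero (KP R Λ) := ⟨Quot.mk _ 0⟩
instance : Add (KP R Λ) :=
  ⟨Quot.map₂ (· + ·) (fun a _ _ h => h.add_left a) fun _ _ c h => h.add_right c⟩
instance : Mul (KP R Λ) :=
  ⟨Quot.map₂ (· * ·) (fun a _ _ h => h.mul_left a) fun _ _ c h => h.mul_right c⟩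
instance : Neg (KP R Λ) := ⟨Quot.map Neg.neg fun _ _ h => h.neg⟩
instance : SMul R (KP R Λ) := ⟨fun c => Quot.map (c • ·) fun _ _ h => h.smul c⟩

instance : NonUnitalRing (KP R Λ) where
  add_assoc := by rintro ⟨a⟩ ⟨b⟩ ⟨c⟩; exact congrArg (Quot.mk _) (add_assoc a b c)
  zero_add := by rintro ⟨a⟩; exact congrArg (Quot.mk _) (zero_add a)
  add_zero := by rintro ⟨a⟩; exact congrArg (Quot.mk _) (add_zero a)
  add_comm := by rintro ⟨a⟩ ⟨b⟩; exact congrArg (Quot.mk _) (add_comm a b)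
  neg_add_cancel := by rintro ⟨a⟩; exact congrArg (Quot.mk _) (neg_add_cancel a)
  nsmul := nsmulRec
  zsmul := zsmulRec
  left_distrib := by rintro ⟨a⟩ ⟨b⟩ ⟨c⟩; exact congrArg (Quot.mk _) (mul_add a b c)
  right_distrib := by rintro ⟨a⟩ ⟨b⟩ ⟨c⟩; exact congrArg (Quot.mk _) (add_mul a b c)
  zero_mul := by rintro ⟨a⟩; exact congrArg (Quot.mk _) (zero_mul a)
  mul_zero := by rintro ⟨a⟩; exact congrArg (Quot.mk _) (mul_zero a)
  mul_assoc := by rintro ⟨a⟩ ⟨b⟩ ⟨c⟩; exact congrArg (Quot.mk _) (mul_assoc a b c)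

instance : Module R (KP R Λ) where
  one_smul := by rintro ⟨a⟩; exact congrArg (Quot.mk _) (one_smul R a)
  mul_smul := by rintro c d ⟨a⟩; exact congrArg (Quot.mk _) (mul_smul c d a)
  smul_zero c := congrArg (Quot.mk _) (smul_zero c)
  smul_add := by rintro c ⟨a⟩ ⟨b⟩; exact congrArg (Quot.mk _) (smul_add c a b)
  add_smul := by rintro c d ⟨a⟩; exact congrArg (Quot.mk _) (add_smul c d a)
  zero_smul := by rintro ⟨a⟩; exact congrArg (Quot.mk _) (zero_smul R a)

instance : IsScalarTower R (KP R Λ) (KP R Λ) :=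
  ⟨by rintro c ⟨a⟩ ⟨b⟩; exact congrArg (Quot.mk _) (smul_mul_assoc c a b)⟩

instance : SMulCommClass R (KP R Λ) (KP R Λ) :=
  ⟨by rintro c ⟨a⟩ ⟨b⟩; exact congrArg (Quot.mk _) (mul_smul_comm c a b).symm⟩

variable (R) (Λ)

/-- The vertex idempotent `p_v`. -/
def p (v : Λ.Vert) : KP R Λ := Quot.mk _ (genP R v)

/-- The element `s_λ`, with `s_v = p_v` for a vertex `v`. -/
def s (f : Λ.Path) : KP R Λ := Quot.mk _ (genS R f)

/-- The element `s_{λ^*}`, with `s_{v^*} = p_v` for a vertex `v`. -/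
def t (f : Λ.Path) : KP R Λ := Quot.mk _ (genT R f)

end KP
end KP

section Morita
variable (R : Type v) [CommRing R] (Λ : KGraph.{u} k) [Λ.LocallyConvex] [Λ.RowFinite]

/-- The subalgebra `B(Λ̃)` of `KP_R(Λ̃)` generated by the elements attached to `ι(Λ)`. -/
def algB : NonUnitalSubalgebra R (KP R Λ.desourcification) :=
  NonUnitalAlgebra.adjoin R
    (Set.range (fun v => KP.p R Λ.desourcification (Λ.iotaVert v)) ∪
      Set.range (fun f => KP.s R Λ.desourcification (Λ.iotaPath f)) ∪
      Set.range (fun f => KP.t R Λ.desourcification (Λ.iotaPath f)))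

/-- `M = span {t_λ t_{μ^*} : r(μ) ∈ ι(Λ^0)}`. -/
def modM : Submodule R (KP R Λ.desourcification) :=
  Submodule.span R {x | ∃ f g : Λ.desourcification.Path,
    Λ.desourcification.r g ∈ Set.range Λ.iotaVert ∧
      x = KP.s R Λ.desourcification f * KP.t R Λ.desourcification g}

/-- `N = span {t_λ t_{μ^*} : r(λ) ∈ ι(Λ^0)}`. -/
def modN : Submodule R (KP R Λ.desourcification) :=
  Submodule.span R {x | ∃ f g : Λ.desourcification.Path,
    Λ.desourcification.r f ∈ Set.range Λ.iotaVert ∧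
      x = KP.s R Λ.desourcification f * KP.t R Λ.desourcification g}

end Morita

end KGraph

/-! ### Morita contexts of (possibly non-unital) rings -/

open scoped TensorProduct

/-- The structure of an `A`-`B` bimodule on the abelian group `M`, with left action `a · m = l a m`
and right action `m · b = r b m`. -/
structure RingBimod (A : Type u) (B : Type v) [NonUnitalRing A] [NonUnitalRing B]
    (M : Type w) [AddCommGroup M] where
  l : A →+ M →+ M
  r : B →+ M →+ M
  mul_l : ∀ a a' m, l (a * a') m = l a (l a' m)
  mul_r : ∀ b b' m, r (b * b') m = r b' (r b m)
  comm : ∀ a b m, r b (l a m) = l a (r b m)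

namespace RingBimod

universe u₁ u₂ u₃ u₄ u₅

/-- A ring as a bimodule over itself. -/
def self (A : Type u₁) [NonUnitalRing A] : RingBimod A A A where
  l := AddMonoidHom.mul
  r := AddMonoidHom.mul.flip
  mul_l := mul_assoc
  mul_r b b' m := (mul_assoc m b b').symm
  comm a b m := mul_assoc a m b

variable {A : Type u₁} {B : Type u₂} {C : Type u₃} {M : Type u₄} {N : Type u₅}
  [NonUnitalRing A] [NonUnitalRing B] [NonUnitalRing C] [AddCommGroup M] [AddCommGroup N]

/-- The subgroup of `M ⊗_ℤ N` generated by the elements `(m · b) ⊗ n - m ⊗ (b · n)`. -/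
def balancing (X : RingBimod A B M) (Y : RingBimod B C N) : AddSubgroup (M ⊗[ℤ] N) :=
  AddSubgroup.closure {x | ∃ m b n, x = (X.r b m) ⊗ₜ[ℤ] n - m ⊗ₜ[ℤ] (Y.l b n)}

/-- The tensor product `M ⊗_B N`. -/
def Tensor (X : RingBimod A B M) (Y : RingBimod B C N) : Type (max u₄ u₅) := (M ⊗[ℤ] N) ⧸ balancing X Y

instance (X : RingBimod A B M) (Y : RingBimod B C N) : AddCommGroup (Tensor X Y) :=
  inferInstanceAs (AddCommGroup ((M ⊗[ℤ] N) ⧸ balancing X Y))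

/-- The elementary tensor `m ⊗_B n`. -/
def tmul (X : RingBimod A B M) (Y : RingBimod B C N) (m : M) (n : N) : Tensor X Y :=
  QuotientAddGroup.mk (m ⊗ₜ[ℤ] n)

theorem tensor_hom_ext {X : RingBimod A B M} {Y : RingBimod B C N} {G : Type*} [AddCommGroup G]
    {f g : Tensor X Y →+ G} (h : ∀ m n, f (tmul X Y m n) = g (tmul X Y m n)) : f = g := by
  refine QuotientAddGroup.addMonoidHom_ext _ (AddMonoidHom.ext fun x => ?_)
  induction x using TensorProduct.induction_on with
  | zero => simp
  | tmul m n => exact h m n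
  | add x y hx hy => rw [map_add, map_add, hx, hy]

/-- The endomorphism `m ⊗ n ↦ f m ⊗ g n` of `M ⊗_B N`, for `f`, `g` commuting with the actions
of `B`. -/
def tensorMap (X : RingBimod A B M) (Y : RingBimod B C N) (f : M →+ M) (g : N →+ N)
    (hf : ∀ b m, f (X.r b m) = X.r b (f m)) (hg : ∀ b n, g (Y.l b n) = Y.l b (g n)) :
    Tensor X Y →+ Tensor X Y :=
  QuotientAddGroup.map (balancing X Y) (balancing X Y)
    (TensorProduct.map f.toIntLinearMap g.toIntLinearMap).toAddMonoidHom (by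
      refine (AddSubgroup.closure_le _).2 ?_
      rintro _ ⟨m, b, n, rfl⟩
      refine AddSubgroup.subset_closure ⟨f m, b, g n, ?_⟩
      simp [hf, hg])

theorem tensorMap_tmul (X : RingBimod A B M) (Y : RingBimod B C N) (f : M →+ M) (g : N →+ N)
    (hf : ∀ b m, f (X.r b m) = X.r b (f m)) (hg : ∀ b n, g (Y.l b n) = Y.l b (g n)) (m : M) (n : N) :
    tensorMap X Y f g hf hg (tmul X Y m n) = tmul X Y (f m) (g n) := rfl

theorem tmul_add_left (X : RingBimod A B M) (Y : RingBimod B C N) (m m' : M) (n : N) :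
    tmul X Y (m + m') n = tmul X Y m n + tmul X Y m' n :=
  congrArg QuotientAddGroup.mk (TensorProduct.add_tmul m m' n)

theorem tmul_add_right (X : RingBimod A B M) (Y : RingBimod B C N) (m : M) (n n' : N) :
    tmul X Y m (n + n') = tmul X Y m n + tmul X Y m n' :=
  congrArg QuotientAddGroup.mk (TensorProduct.tmul_add m n n')

/-- The left action of `a` on `M ⊗_B N`, `a · (m ⊗ n) = (a · m) ⊗ n`. -/
def tensorL (X : RingBimod A B M) (Y : RingBimod B C N) (a : A) : Tensor X Y →+ Tensor X Y :=
  tensorMap X Y (X.l a) (AddMonoidHom.id N) (fun b m => (X.comm a b m).symm) fun _ _ => rfl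

/-- The right action of `c` on `M ⊗_B N`, `(m ⊗ n) · c = m ⊗ (n · c)`. -/
def tensorR (X : RingBimod A B M) (Y : RingBimod B C N) (c : C) : Tensor X Y →+ Tensor X Y :=
  tensorMap X Y (AddMonoidHom.id M) (Y.r c) (fun _ _ => rfl) fun b n => Y.comm b c n

theorem tensorL_tmul (X : RingBimod A B M) (Y : RingBimod B C N) (a : A) (m : M) (n : N) :
    tensorL X Y a (tmul X Y m n) = tmul X Y (X.l a m) n := rfl

theorem tensorR_tmul (X : RingBimod A B M) (Y : RingBimod B C N) (c : C) (m : M) (n : N) :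
    tensorR X Y c (tmul X Y m n) = tmul X Y m (Y.r c n) := rfl

/-- The `A`-`C` bimodule `M ⊗_B N`. -/
def tensor (X : RingBimod A B M) (Y : RingBimod B C N) : RingBimod A C (Tensor X Y) where
  l := AddMonoidHom.mk' (tensorL X Y) fun a a' => tensor_hom_ext fun m n => by
    rw [AddMonoidHom.add_apply, tensorL_tmul, tensorL_tmul, tensorL_tmul, map_add,
      AddMonoidHom.add_apply, tmul_add_left]
  r := AddMonoidHom.mk' (tensorR X Y) fun c c' => tensor_hom_ext fun m n => by
    rw [AddMonoidHom.add_apply, tensorR_tmul, tensorR_tmul, tensorR_tmul, map_add,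
      AddMonoidHom.add_apply, tmul_add_right]
  mul_l a a' := DFunLike.congr_fun (f := tensorL X Y (a * a'))
    (g := (tensorL X Y a).comp (tensorL X Y a'))
    (tensor_hom_ext fun m n => congrArg (fun z => tmul X Y z n) (X.mul_l a a' m))
  mul_r c c' := DFunLike.congr_fun (f := tensorR X Y (c * c'))
    (g := (tensorR X Y c').comp (tensorR X Y c))
    (tensor_hom_ext fun m n => congrArg (fun z => tmul X Y m z) (Y.mul_r c c' n))
  comm a c := DFunLike.congr_fun (f := (tensorR X Y c).comp (tensorL X Y a))
    (g := (tensorL X Y a).comp (tensorR X Y c)) (tensor_hom_ext fun _ _ => rfl)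

/-- A homomorphism of `A`-`B` bimodules. -/
structure Hom (X : RingBimod A B M) (Y : RingBimod A B N) where
  toFun : M →+ N
  map_l : ∀ a m, toFun (X.l a m) = Y.l a (toFun m)
  map_r : ∀ b m, toFun (X.r b m) = Y.r b (toFun m)

end RingBimod

/-- A Morita context `(A, B, M, N, ψ, φ)` on an `A`-`B` bimodule `M` and a `B`-`A` bimodule `N`:
bimodule homomorphisms `ψ : M ⊗_B N → A` and `φ : N ⊗_A M → B` with
`n' · ψ(m ⊗ n) = φ(n' ⊗ m) · n` and `m' · φ(n ⊗ m) = ψ(m' ⊗ n) · m`. -/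
structure MoritaContext {A B M N : Type*} [NonUnitalRing A] [NonUnitalRing B] [AddCommGroup M]
    [AddCommGroup N] (X : RingBimod A B M) (Y : RingBimod B A N) where
  psi : RingBimod.Hom (RingBimod.tensor X Y) (RingBimod.self A)
  phi : RingBimod.Hom (RingBimod.tensor Y X) (RingBimod.self B)
  psi_phi : ∀ (n' : N) (m : M) (n : N),
    Y.r (psi.toFun (RingBimod.tmul X Y m n)) n' = Y.l (phi.toFun (RingBimod.tmul Y X n' m)) n
  phi_psi : ∀ (m' : M) (n : N) (m : M),
    X.r (phi.toFun (RingBimod.tmul Y X n m)) m' = X.l (psi.toFun (RingBimod.tmul X Y m' n)) m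

/-- A Morita context is surjective if both of its maps are. -/
def MoritaContext.IsSurjective {A B M N : Type*} [NonUnitalRing A] [NonUnitalRing B]
    [AddCommGroup M] [AddCommGroup N] {X : RingBimod A B M} {Y : RingBimod B A N}
    (C : MoritaContext X Y) : Prop :=
  Function.Surjective C.psi.toFun ∧ Function.Surjective C.phi.toFun

end

noncomputable section

namespace KGraph

variable {k : ℕ}

section KP
variable {R : Type v} [CommRing R] {Λ : KGraph.{u} k} [Λ.RowFinite]

namespace KP

theorem s_one (v : Λ.Vert) : KP.s R Λ (Λ.one v) = KP.p R Λ v := Quot.sound (.path_one v)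
theorem t_one (v : Λ.Vert) : KP.t R Λ (Λ.one v) = KP.p R Λ v := Quot.sound (.ghost_one v)
theorem p_mul_self (v : Λ.Vert) : KP.p R Λ v * KP.p R Λ v = KP.p R Λ v :=
  Quot.sound (.kp1_self v)
theorem p_mul_ne {v w : Λ.Vert} (h : v ≠ w) : KP.p R Λ v * KP.p R Λ w = 0 :=
  Quot.sound (.kp1_ne v w h)
theorem s_mul_s {f g h : Λ.Path} (H : Λ.IsComp f g h) :
    KP.s R Λ f * KP.s R Λ g = KP.s R Λ h := by
  obtain ⟨e, rfl⟩ := H; exact Quot.sound (.kp2_path f g e)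
theorem t_mul_t {f g h : Λ.Path} (H : Λ.IsComp f g h) :
    KP.t R Λ g * KP.t R Λ f = KP.t R Λ h := by
  obtain ⟨e, rfl⟩ := H; exact Quot.sound (.kp2_ghost f g e)
theorem p_mul_s (f : Λ.Path) : KP.p R Λ (Λ.r f) * KP.s R Λ f = KP.s R Λ f :=
  Quot.sound (.kp2_range_path f)
theorem s_mul_p (f : Λ.Path) : KP.s R Λ f * KP.p R Λ (Λ.s f) = KP.s R Λ f :=
  Quot.sound (.kp2_path_source f)
theorem p_mul_t (f : Λ.Path) : KP.p R Λ (Λ.s f) * KP.t R Λ f = KP.t R Λ f :=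
  Quot.sound (.kp2_source_ghost f)
theorem t_mul_p (f : Λ.Path) : KP.t R Λ f * KP.p R Λ (Λ.r f) = KP.t R Λ f :=
  Quot.sound (.kp2_ghost_range f)

variable (R Λ) in
/-- The quotient map from the free algebra. -/
def mk : FreeAlg R Λ →+ KP R Λ where
  toFun := Quot.mk _
  map_zero' := rfl
  map_add' _ _ := rfl

omit [Λ.RowFinite] in
theorem maxPaths_zero : ∀ f ∈ Λ.maxPaths 0, f = Λ.one (Λ.r f) := fun f hf =>
  eq_one_of_d f (le_antisymm hf.1 fun _ => Nat.zero_le _)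

theorem t_mul_s_self (f : Λ.Path) : KP.t R Λ f * KP.s R Λ f = KP.p R Λ (Λ.s f) := by
  by_cases h : Λ.d f = 0
  · rw [eq_one_of_d f h, s_one, t_one, p_mul_self, Λ.s_one]
  · exact Quot.sound (.kp3_self _ f h ⟨le_rfl, fun i hi => absurd hi (lt_irrefl _)⟩)

theorem t_mul_s_ne {n : Fin k → ℕ} {f g : Λ.Path} (hf : f ∈ Λ.maxPaths n)
    (hg : g ∈ Λ.maxPaths n) (h : f ≠ g) : KP.t R Λ f * KP.s R Λ g = 0 := by
  by_cases hn : n = 0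
  · subst hn
    rw [maxPaths_zero f hf, maxPaths_zero g hg] at h ⊢
    rw [t_one, s_one]
    exact p_mul_ne fun hc => h (by rw [hc])
  · exact Quot.sound (.kp3_ne n f g hn hf hg h)

theorem p_eq_sum (v : Λ.Vert) (n : Fin k → ℕ) :
    KP.p R Λ v = ∑ f ∈ (Λ.maxPathsOf_finite v n).toFinset, KP.s R Λ f * KP.t R Λ f := by
  by_cases hn : n = 0
  · subst hn
    have : (Λ.maxPathsOf_finite v 0).toFinset = {Λ.one v} := by
      ext f
      rw [Set.Finite.mem_toFinset, Finset.mem_singleton]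
      constructor
      · rintro ⟨rfl, h⟩
        exact maxPaths_zero f h
      · rintro rfl
        exact ⟨Λ.r_one v, by rw [Λ.d_one], fun i hi => absurd hi (Nat.not_lt_zero _)⟩
    rw [this, Finset.sum_singleton, s_one, t_one, p_mul_self]
  · exact (Quot.sound (.kp4 v n hn)).trans (map_sum (mk R Λ) _ _)

theorem s_mul_s_ne {f g : Λ.Path} (h : Λ.s f ≠ Λ.r g) : KP.s R Λ f * KP.s R Λ g = 0 := by
  rw [← s_mul_p f, ← p_mul_s g, mul_assoc, ← mul_assoc (KP.p R Λ (Λ.s f)), p_mul_ne h, zero_mul,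
    mul_zero]

theorem t_mul_t_ne {f g : Λ.Path} (h : Λ.s f ≠ Λ.r g) : KP.t R Λ g * KP.t R Λ f = 0 := by
  rw [← t_mul_p g, ← p_mul_t f, mul_assoc, ← mul_assoc (KP.p R Λ (Λ.r g)), p_mul_ne h.symm,
    zero_mul, mul_zero]

theorem s_mul_t_ne {f g : Λ.Path} (h : Λ.s f ≠ Λ.s g) : KP.s R Λ f * KP.t R Λ g = 0 := by
  rw [← s_mul_p f, ← p_mul_t g, mul_assoc, ← mul_assoc (KP.p R Λ (Λ.s f)), p_mul_ne h,
    zero_mul, mul_zero]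

/-- A non-unital subalgebra containing the generators is everything. -/
theorem mem_of_generators (S : NonUnitalSubalgebra R (KP R Λ)) (hp : ∀ v, KP.p R Λ v ∈ S)
    (hs : ∀ f, KP.s R Λ f ∈ S) (ht : ∀ f, KP.t R Λ f ∈ S) (x : KP R Λ) : x ∈ S := by
  obtain ⟨a⟩ := x
  have hw : ∀ w : FreeSemigroup Λ.Gen,
      (Quot.mk _ (MonoidAlgebra.single w 1) : KP R Λ) ∈ S := by
    intro w
    induction w using FreeSemigroup.recOnMul with
    | ih1 g =>
      cases g with
      | vert v => exact hp v
      | path f => exact hs f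
      | ghost f => exact ht f
    | ih2 a b ha hb =>
      have := S.mul_mem ha hb
      have e : (MonoidAlgebra.single (FreeSemigroup.of a * b) 1 : FreeAlg R Λ) =
          MonoidAlgebra.single (FreeSemigroup.of a) 1 * MonoidAlgebra.single b 1 := by
        rw [MonoidAlgebra.single_mul_single, one_mul]
      rw [e]
      exact this
  induction a using MonoidAlgebra.induction_linear with
  | zero => exact S.zero_mem
  | add a b ha hb => exact S.add_mem ha hb
  | single w c =>
    have e : (MonoidAlgebra.single w c : FreeAlg R Λ) = c • MonoidAlgebra.single w 1 := by
      rw [MonoidAlgebra.smul_single, smul_eq_mul, mul_one]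
    rw [e]
    exact (S.toSubmodule.smul_mem c (hw w) : c • mk R Λ _ ∈ S)

end KP

/-- A Kumjian-Pask `Λ`-family in the `R`-algebra `A`. -/
structure KPFamily (Λ : KGraph.{u} k) [Λ.RowFinite] (A : Type w) [NonUnitalRing A] where
  p : Λ.Vert → A
  s : Λ.Path → A
  t : Λ.Path → A
  path_one : ∀ v, s (Λ.one v) = p v
  ghost_one : ∀ v, t (Λ.one v) = p v
  p_mul_self : ∀ v, p v * p v = p v
  p_mul_ne : ∀ v w, v ≠ w → p v * p w = 0
  s_mul_s : ∀ f g h, Λ.IsComp f g h → s f * s g = s h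
  t_mul_t : ∀ f g h, Λ.IsComp f g h → t g * t f = t h
  p_mul_s : ∀ f, p (Λ.r f) * s f = s f
  s_mul_p : ∀ f, s f * p (Λ.s f) = s f
  p_mul_t : ∀ f, p (Λ.s f) * t f = t f
  t_mul_p : ∀ f, t f * p (Λ.r f) = t f
  t_mul_s_self : ∀ f, t f * s f = p (Λ.s f)
  t_mul_s_ne : ∀ n, ∀ f ∈ Λ.maxPaths n, ∀ g ∈ Λ.maxPaths n, f ≠ g → t f * s g = 0
  p_eq_sum : ∀ v n, p v = ∑ f ∈ (Λ.maxPathsOf_finite v n).toFinset, s f * t f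

namespace KPFamily
variable {A : Type w} [NonUnitalRing A] [Module R A] [IsScalarTower R A A] [SMulCommClass R A A]
  (F : KPFamily Λ A)

variable (R) in
/-- The homomorphism from the free algebra determined by the family. -/
def freeLift : FreeAlg R Λ →ₙₐ[R] A :=
  MonoidAlgebra.liftMagma R (FreeSemigroup.lift fun g : Λ.Gen => Gen.casesOn g F.p F.s F.t)

theorem freeLift_gen (g : Λ.Gen) : F.freeLift R (gen R g) = Gen.casesOn g F.p F.s F.t := by
  simp [freeLift, gen, MonoidAlgebra.liftMagma]

theorem freeLift_genP (v : Λ.Vert) : F.freeLift R (genP R v) = F.p v := F.freeLift_gen _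
theorem freeLift_genS (f : Λ.Path) : F.freeLift R (genS R f) = F.s f := F.freeLift_gen _
theorem freeLift_genT (f : Λ.Path) : F.freeLift R (genT R f) = F.t f := F.freeLift_gen _

theorem freeLift_eq {a b : FreeAlg R Λ} (h : KPRel R Λ a b) : F.freeLift R a = F.freeLift R b := by
  induction h with
  | path_one v => simp only [freeLift_genP, freeLift_genS, path_one]
  | ghost_one v => simp only [freeLift_genP, freeLift_genT, ghost_one]
  | kp1_self v => simp only [map_mul, freeLift_genP, p_mul_self]
  | kp1_ne v w h => simp only [map_mul, freeLift_genP, map_zero, F.p_mul_ne v w h]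
  | kp2_path f g h => simp only [map_mul, freeLift_genS, F.s_mul_s f g _ ⟨h, rfl⟩]
  | kp2_ghost f g h => simp only [map_mul, freeLift_genT, F.t_mul_t f g _ ⟨h, rfl⟩]
  | kp2_range_path f => simp only [map_mul, freeLift_genP, freeLift_genS, p_mul_s]
  | kp2_path_source f => simp only [map_mul, freeLift_genP, freeLift_genS, s_mul_p]
  | kp2_source_ghost f => simp only [map_mul, freeLift_genP, freeLift_genT, p_mul_t]
  | kp2_ghost_range f => simp only [map_mul, freeLift_genP, freeLift_genT, t_mul_p]
  | kp3_self n f _ _ => simp only [map_mul, freeLift_genP, freeLift_genS, freeLift_genT, t_mul_s_self]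
  | kp3_ne n f g _ hf hg h =>
    simp only [map_mul, map_zero, freeLift_genS, freeLift_genT, F.t_mul_s_ne n f hf g hg h]
  | kp4 v n _ =>
    rw [map_sum, freeLift_genP, F.p_eq_sum v n]
    simp only [map_mul, freeLift_genS, freeLift_genT]
  | smul c _ ih => rw [map_smul, map_smul, ih]
  | add_right c _ ih => rw [map_add, map_add, ih]
  | mul_left a _ ih => rw [map_mul, map_mul, ih]
  | mul_right c _ ih => rw [map_mul, map_mul, ih]

variable (R) in
/-- The universal property of `KP_R(Λ)`. -/
def lift : KP R Λ →ₙₐ[R] A where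
  toFun := Quot.lift (F.freeLift R) fun _ _ => F.freeLift_eq
  map_smul' c x := by obtain ⟨a⟩ := x; exact map_smul (F.freeLift R) c a
  map_zero' := map_zero (F.freeLift R)
  map_add' x y := by obtain ⟨a⟩ := x; obtain ⟨b⟩ := y; exact map_add (F.freeLift R) a b
  map_mul' x y := by obtain ⟨a⟩ := x; obtain ⟨b⟩ := y; exact map_mul (F.freeLift R) a b

theorem lift_p (v : Λ.Vert) : F.lift R (KP.p R Λ v) = F.p v := F.freeLift_genP v
theorem lift_s (f : Λ.Path) : F.lift R (KP.s R Λ f) = F.s f := F.freeLift_genS f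
theorem lift_t (f : Λ.Path) : F.lift R (KP.t R Λ f) = F.t f := F.freeLift_genT f

end KPFamily

/-! ### Corners of Kumjian-Pask algebras of `k`-graphs without sources -/

variable (R Λ) in
/-- The span of the elements `s_λ s_{μ^*}` with `r(λ) ∈ U` and `r(μ) ∈ V`. -/
def corner (U V : Set Λ.Vert) : Submodule R (KP R Λ) :=
  Submodule.span R {x | ∃ f g, Λ.r f ∈ U ∧ Λ.r g ∈ V ∧ x = KP.s R Λ f * KP.t R Λ g}

theorem s_mul_t_mem_corner {U V : Set Λ.Vert} {f g : Λ.Path} (hf : Λ.r f ∈ U) (hg : Λ.r g ∈ V) :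
    KP.s R Λ f * KP.t R Λ g ∈ corner R Λ U V :=
  Submodule.subset_span ⟨f, g, hf, hg, rfl⟩

theorem p_mem_corner {U V : Set Λ.Vert} {v : Λ.Vert} (hU : v ∈ U) (hV : v ∈ V) :
    KP.p R Λ v ∈ corner R Λ U V := by
  rw [← KP.p_mul_self]
  nth_rewrite 1 [← KP.s_one]
  rw [← KP.t_one]
  exact s_mul_t_mem_corner (by rwa [Λ.r_one]) (by rwa [Λ.r_one])

theorem s_mem_corner {U V : Set Λ.Vert} {f : Λ.Path} (hU : Λ.r f ∈ U) (hV : Λ.s f ∈ V) :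
    KP.s R Λ f ∈ corner R Λ U V := by
  rw [← KP.s_mul_p, ← KP.t_one]
  exact s_mul_t_mem_corner hU (by rwa [Λ.r_one])

theorem t_mem_corner {U V : Set Λ.Vert} {f : Λ.Path} (hU : Λ.s f ∈ U) (hV : Λ.r f ∈ V) :
    KP.t R Λ f ∈ corner R Λ U V := by
  rw [← KP.p_mul_t, ← KP.s_one]
  exact s_mul_t_mem_corner (by rwa [Λ.r_one]) hV

omit [Λ.RowFinite] in
theorem NoSources.mem_maxPaths_iff (h : Λ.NoSources) {n : Fin k → ℕ} {f : Λ.Path} :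
    f ∈ Λ.maxPaths n ↔ Λ.d f = n := by
  constructor
  · rintro ⟨h1, h2⟩
    funext i
    refine le_antisymm (h1 i) (not_lt.1 fun hi => ?_)
    have := h (Λ.s f) (e i)
    rw [h2 i hi] at this
    exact Set.not_nonempty_empty this
  · rintro rfl
    exact ⟨le_rfl, fun i hi => absurd hi (lt_irrefl _)⟩

theorem s_mul_mul_t_mem_corner {U V : Set Λ.Vert} {f g : Λ.Path} (hf : Λ.r f ∈ U)
    (hg : Λ.r g ∈ V) {x : KP R Λ} (hx : x ∈ corner R Λ Set.univ Set.univ) :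
    KP.s R Λ f * x * KP.t R Λ g ∈ corner R Λ U V := by
  induction hx using Submodule.span_induction with
  | zero => rw [mul_zero, zero_mul]; exact zero_mem _
  | add x y _ _ hx hy => rw [mul_add, add_mul]; exact add_mem hx hy
  | smul c x _ hx => rw [mul_smul_comm, smul_mul_assoc]; exact Submodule.smul_mem _ c hx
  | mem x hx =>
    obtain ⟨a, b, -, -, rfl⟩ := hx
    rw [← mul_assoc, mul_assoc]
    by_cases h1 : Λ.s f = Λ.r a
    · by_cases h2 : Λ.s g = Λ.r b
      · have H1 : Λ.IsComp f a _ := ⟨h1, rfl⟩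
        have H2 : Λ.IsComp g b _ := ⟨h2, rfl⟩
        rw [KP.s_mul_s H1, KP.t_mul_t H2]
        exact s_mul_t_mem_corner (by rwa [H1.r]) (by rwa [H2.r])
      · rw [KP.t_mul_t_ne h2, mul_zero]; exact zero_mem _
    · rw [KP.s_mul_s_ne h1, zero_mul]; exact zero_mem _

theorem NoSources.t_mul_s_mem_corner (h : Λ.NoSources) (f g : Λ.Path) :
    KP.t R Λ f * KP.s R Λ g ∈ corner R Λ Set.univ Set.univ := by
  set n := Λ.d f ⊔ Λ.d g
  rw [← KP.p_mul_t f, ← KP.s_mul_p g, KP.p_eq_sum (Λ.s f) (n - Λ.d f),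
    KP.p_eq_sum (Λ.s g) (n - Λ.d g), Finset.sum_mul, Finset.mul_sum, Finset.sum_mul]
  refine Submodule.sum_mem _ fun a ha => ?_
  rw [Finset.mul_sum]
  refine Submodule.sum_mem _ fun b hb => ?_
  rw [Set.Finite.mem_toFinset] at ha hb
  have H1 : Λ.IsComp f a _ := ⟨ha.1.symm, rfl⟩
  have H2 : Λ.IsComp g b _ := ⟨hb.1.symm, rfl⟩
  rw [mul_assoc (KP.s R Λ a), KP.t_mul_t H1, ← mul_assoc (KP.s R Λ g), KP.s_mul_s H2,
    ← mul_assoc, mul_assoc (KP.s R Λ a)]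
  refine s_mul_mul_t_mem_corner (Set.mem_univ _) (Set.mem_univ _) ?_
  have d1 : Λ.d (Λ.comp f a ha.1.symm) = n := by
    rw [H1.deg, h.mem_maxPaths_iff.1 ha.2, add_tsub_cancel_of_le le_sup_left]
  have d2 : Λ.d (Λ.comp g b hb.1.symm) = n := by
    rw [H2.deg, h.mem_maxPaths_iff.1 hb.2, add_tsub_cancel_of_le le_sup_right]
  by_cases hab : Λ.comp f a ha.1.symm = Λ.comp g b hb.1.symm
  · rw [hab, KP.t_mul_s_self]
    exact p_mem_corner (Set.mem_univ _) (Set.mem_univ _)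
  · rw [KP.t_mul_s_ne (h.mem_maxPaths_iff.2 d1) (h.mem_maxPaths_iff.2 d2) hab]
    exact zero_mem _

theorem NoSources.mul_mem_corner (h : Λ.NoSources) {U V V' W : Set Λ.Vert} {x y : KP R Λ}
    (hx : x ∈ corner R Λ U V) (hy : y ∈ corner R Λ V' W) : x * y ∈ corner R Λ U W := by
  induction hx using Submodule.span_induction with
  | zero => rw [zero_mul]; exact zero_mem _
  | add x z _ _ hx hz => rw [add_mul]; exact add_mem hx hz
  | smul c x _ hx => rw [smul_mul_assoc]; exact Submodule.smul_mem _ c hx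
  | mem x hx =>
    obtain ⟨a, b, ha, -, rfl⟩ := hx
    induction hy using Submodule.span_induction with
    | zero => rw [mul_zero]; exact zero_mem _
    | add x z _ _ hx hz => rw [mul_add]; exact add_mem hx hz
    | smul c x _ hx => rw [mul_smul_comm]; exact Submodule.smul_mem _ c hx
    | mem x hx =>
      obtain ⟨a', b', -, hb', rfl⟩ := hx
      have := s_mul_mul_t_mem_corner ha hb' (h.t_mul_s_mem_corner (R := R) b a')
      simpa only [mul_assoc] using this

/-- The corners are subalgebras. -/
def NoSources.cornerSubalgebra (h : Λ.NoSources) (U : Set Λ.Vert) :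
    NonUnitalSubalgebra R (KP R Λ) :=
  { corner R Λ U U with mul_mem' := fun hx hy => h.mul_mem_corner hx hy }

theorem NoSources.mem_corner_univ (h : Λ.NoSources) (x : KP R Λ) :
    x ∈ corner R Λ Set.univ Set.univ :=
  KP.mem_of_generators (h.cornerSubalgebra Set.univ)
    (fun _ => p_mem_corner (Set.mem_univ _) (Set.mem_univ _))
    (fun _ => s_mem_corner (Set.mem_univ _) (Set.mem_univ _))
    (fun _ => t_mem_corner (Set.mem_univ _) (Set.mem_univ _)) x

end KP

end KGraph

/-- The Morita context given by multiplication in a ring `A`, for submodules `M` and `N` of `A`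
and a ring `D` embedded in `A`. -/
theorem exists_moritaContext_of_mul {R A D : Type*} [CommRing R] [NonUnitalRing A] [Module R A]
    [NonUnitalRing D] (M N : Submodule R A) (j : D →ₙ+* A) (hj : Function.Injective j)
    (hAM : ∀ a, ∀ m ∈ M, a * m ∈ M) (hMD : ∀ m ∈ M, ∀ b, m * j b ∈ M)
    (hDN : ∀ b, ∀ n ∈ N, j b * n ∈ N) (hNA : ∀ n ∈ N, ∀ a, n * a ∈ N)
    (hNM : ∀ n ∈ N, ∀ m ∈ M, ∃ b, j b = n * m)
    (hpsi : ∀ a, a ∈ AddSubgroup.closure {x | ∃ m ∈ M, ∃ n ∈ N, m * n = x})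
    (hphi : ∀ b, j b ∈ AddSubgroup.closure {x | ∃ n ∈ N, ∃ m ∈ M, n * m = x}) :
    ∃ (X : RingBimod A D M) (Y : RingBimod D A N),
      (∀ a (m : M), (X.l a m : A) = a * m) ∧ (∀ b (m : M), (X.r b m : A) = m * j b) ∧
      (∀ b (n : N), (Y.l b n : A) = j b * n) ∧ (∀ a (n : N), (Y.r a n : A) = n * a) ∧
      ∃ C : MoritaContext X Y,
        (∀ m n, C.psi.toFun (RingBimod.tmul X Y m n) = m * n) ∧
        (∀ n m, j (C.phi.toFun (RingBimod.tmul Y X n m)) = n * m) ∧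
        C.IsSurjective := by
  let X : RingBimod A D M :=
    { l := AddMonoidHom.mk' (fun a => AddMonoidHom.mk' (fun m => ⟨a * m, hAM a m m.2⟩)
          fun m m' => Subtype.ext (mul_add a _ _))
          fun a a' => AddMonoidHom.ext fun m => Subtype.ext (add_mul a a' _)
      r := AddMonoidHom.mk' (fun b => AddMonoidHom.mk' (fun m => ⟨m * j b, hMD m m.2 b⟩)
          fun m m' => Subtype.ext (add_mul _ _ _))
          fun b b' => AddMonoidHom.ext fun m => Subtype.ext (by
            change (m : A) * j (b + b') = m * j b + m * j b'
            rw [map_add, mul_add])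
      mul_l := fun a a' m => Subtype.ext (mul_assoc a a' _)
      mul_r := fun b b' m => Subtype.ext (by
        change (m : A) * j (b * b') = m * j b * j b'
        rw [map_mul, mul_assoc])
      comm := fun a b m => Subtype.ext (mul_assoc a (m : A) (j b)) }
  let Y : RingBimod D A N :=
    { l := AddMonoidHom.mk' (fun b => AddMonoidHom.mk' (fun n => ⟨j b * n, hDN b n n.2⟩)
          fun m m' => Subtype.ext (mul_add _ _ _))
          fun b b' => AddMonoidHom.ext fun n => Subtype.ext (by
            change j (b + b') * (n : A) = j b * n + j b' * n
            rw [map_add, add_mul])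
      r := AddMonoidHom.mk' (fun a => AddMonoidHom.mk' (fun n => ⟨n * a, hNA n n.2 a⟩)
          fun m m' => Subtype.ext (add_mul _ _ _))
          fun a a' => AddMonoidHom.ext fun n => Subtype.ext (mul_add (n : A) a a')
      mul_l := fun b b' n => Subtype.ext (by
        change j (b * b') * (n : A) = j b * (j b' * n)
        rw [map_mul, mul_assoc])
      mul_r := fun a a' n => Subtype.ext (mul_assoc (n : A) a a').symm
      comm := fun b a n => Subtype.ext (mul_assoc (j b) (n : A) a) }
  let psi : RingBimod.Tensor X Y →+ A :=
    QuotientAddGroup.lift _ (TensorProduct.liftAddHom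
      ((AddMonoidHom.mul.comp M.subtype.toAddMonoidHom).compl₂ N.subtype.toAddMonoidHom)
      fun c m n => by simpa using (mul_smul_comm c (m : A) (n : A)).symm) (by
        refine (AddSubgroup.closure_le _).2 ?_
        rintro _ ⟨m, b, n, rfl⟩
        rw [SetLike.mem_coe, AddMonoidHom.mem_ker, map_sub, sub_eq_zero]
        exact mul_assoc (m : A) (j b) n)
  have hpsi_tmul : ∀ m n, psi (RingBimod.tmul X Y m n) = m * n := fun m n => rfl
  choose F hF using fun (n : N) (m : M) => hNM n n.2 m m.2
  let G : N →+ M →+ D := AddMonoidHom.mk' (fun n => AddMonoidHom.mk' (F n) fun m m' => hj (by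
      rw [map_add, hF, hF, hF]; exact mul_add (n : A) m m')) fun n n' =>
      AddMonoidHom.ext fun m => hj (by
        change j (F _ _) = j (F _ _ + F _ _)
        rw [map_add, hF, hF, hF]; exact add_mul (n : A) n' m)
  let phi : RingBimod.Tensor Y X →+ D :=
    QuotientAddGroup.lift _ (TensorProduct.liftAddHom G fun c n m => by simp) (by
        refine (AddSubgroup.closure_le _).2 ?_
        rintro _ ⟨n, a, m, rfl⟩
        rw [SetLike.mem_coe, AddMonoidHom.mem_ker, map_sub, sub_eq_zero]
        change F (Y.r a n) m = F n (X.l a m)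
        apply hj
        rw [hF, hF]
        exact mul_assoc (n : A) a m)
  have hphi_tmul : ∀ n m, j (phi (RingBimod.tmul Y X n m)) = n * m := fun n m => hF n m
  refine ⟨X, Y, fun _ _ => rfl, fun _ _ => rfl, fun _ _ => rfl, fun _ _ => rfl,
    ⟨⟨psi, fun a z => ?_, fun a z => ?_⟩, ⟨phi, fun b z => ?_, fun b z => ?_⟩, ?_, ?_⟩,
    hpsi_tmul, hphi_tmul, ?_, ?_⟩
  · exact DFunLike.congr_fun (f := psi.comp (RingBimod.tensorL X Y a))
      (g := (AddMonoidHom.mulLeft a).comp psi)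
      (RingBimod.tensor_hom_ext fun m n => mul_assoc a (m : A) n) z
  · exact DFunLike.congr_fun (f := psi.comp (RingBimod.tensorR X Y a))
      (g := (AddMonoidHom.mulRight a).comp psi)
      (RingBimod.tensor_hom_ext fun m n => (mul_assoc (m : A) n a).symm) z
  · exact DFunLike.congr_fun (f := phi.comp (RingBimod.tensorL Y X b))
      (g := (AddMonoidHom.mulLeft b).comp phi)
      (RingBimod.tensor_hom_ext fun n m => hj (by
        change j (F (Y.l b n) m) = j (b * F n m)
        rw [map_mul, hF, hF]
        exact mul_assoc (j b) (n : A) m)) z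
  · exact DFunLike.congr_fun (f := phi.comp (RingBimod.tensorR Y X b))
      (g := (AddMonoidHom.mulRight b).comp phi)
      (RingBimod.tensor_hom_ext fun n m => hj (by
        change j (F n (X.r b m)) = j (F n m * b)
        rw [map_mul, hF, hF]
        exact (mul_assoc (n : A) m (j b)).symm)) z
  · intro n' m n
    refine Subtype.ext ?_
    change (n' : A) * ((m : A) * n) = j (F n' m) * n
    rw [hF, mul_assoc]
  · intro m' n m
    refine Subtype.ext ?_
    change (m' : A) * j (F n m) = (m' : A) * n * m
    rw [hF, mul_assoc]
  · intro a
    change a ∈ psi.range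
    refine (AddSubgroup.closure_le _).2 ?_ (hpsi a)
    rintro _ ⟨m, hm, n, hn, rfl⟩
    exact ⟨RingBimod.tmul X Y ⟨m, hm⟩ ⟨n, hn⟩, rfl⟩
  · intro b
    have : j b ∈ ((j : D →+ A).comp phi).range := by
      refine (AddSubgroup.closure_le _).2 ?_ (hphi b)
      rintro _ ⟨n, hn, m, hm, rfl⟩
      exact ⟨RingBimod.tmul Y X ⟨n, hn⟩ ⟨m, hm⟩, hphi_tmul _ _⟩
    obtain ⟨z, hz⟩ := this
    exact ⟨z, hj hz⟩

namespace KGraph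

variable {k : ℕ}

/-! ### Vertices and paths of the desourcification in terms of their keys -/

section keys
variable {Λ : KGraph.{u} k}

theorem pathsOf_r_nonempty {f : Λ.Path} {i : Fin k} (h : Λ.d f i ≠ 0) :
    (Λ.pathsOf (Λ.r f) (e i)).Nonempty := by
  have hle : e i ≤ Λ.d f := by
    intro j
    by_cases hj : j = i
    · subst hj; simp [e]; omega
    · simp [e, hj]
  obtain ⟨g, hg, hgd⟩ := exists_pfx f (e i) hle
  exact ⟨g, hg.r.symm, hgd⟩

theorem d_eq_zero_of_pathsOf_eq_empty {f : Λ.Path} {i : Fin k}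
    (h : Λ.pathsOf (Λ.r f) (e i) = ∅) : Λ.d f i = 0 := by
  by_contra hc
  have := pathsOf_r_nonempty hc
  rw [h] at this
  exact Set.not_nonempty_empty this

theorem pathsOf_s_eq_empty {f : Λ.Path} {i : Fin k} (h : Λ.pathsOf (Λ.r f) (e i) = ∅) :
    Λ.pathsOf (Λ.s f) (e i) = ∅ := by
  by_contra hc
  obtain ⟨g, hg, hgd⟩ := Set.nonempty_iff_ne_empty.2 hc
  have H : Λ.IsComp f g _ := ⟨hg.symm, rfl⟩
  rw [← H.r] at h
  have h1 := d_eq_zero_of_pathsOf_eq_empty h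
  rw [H.deg, hgd] at h1
  simp [e] at h1

theorem BoundaryPath.deg_eq_zero (x : Λ.BoundaryPath) {i : Fin k}
    (h : Λ.pathsOf x.range (e i) = ∅) : x.deg i = 0 := by
  by_contra hc
  have hle : ∀ j, (e i j : ℕ∞) ≤ x.deg j := by
    intro j
    by_cases hj : j = i
    · subst hj
      simpa [e] using Order.one_le_iff_pos.2 (pos_iff_ne_zero.2 hc)
    · simp [e, hj]
  have hmem : x.seg 0 (e i) (fun _ => Nat.zero_le _) hle ∈ Λ.pathsOf x.range (e i) :=
    ⟨x.r_seg _ _ _ _, by rw [x.d_seg]; simp⟩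
  rw [h] at hmem
  exact hmem

theorem TVert.pathsOf_eq_empty (v : Λ.TVert) {i : Fin k} (h : v.key.2 i ≠ 0) :
    Λ.pathsOf v.key.1 (e i) = ∅ := by
  obtain ⟨v⟩ := v
  refine v.x.no_edge _ (meet_le_right _ _) i ?_
  change v.m i - meet v.m v.x.deg i ≠ 0 at h
  rcases meet_cases v.m v.x.deg i with ⟨-, h2⟩ | ⟨t, h1, h2⟩
  · omega
  · rw [h1, Nat.cast_inj]; omega

theorem TPath.key_mem_maxPaths (a : Λ.TPath) : a.key.1 ∈ Λ.maxPaths a.key.2.2 := by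
  refine ⟨a.d_key_le, fun i hi => ?_⟩
  have h := a.s.pathsOf_eq_empty (i := i)
  rw [TPath.key_s] at h
  refine h ?_
  simp only [Pi.sub_apply, Pi.add_apply]
  omega

/-- Every pair consisting of a vertex `v` of `Λ̃` and a path in `Λ^{≤ n}` starting at the base of `v`
comes from a path in `vΛ̃^n`. -/
theorem TVert.exists_path [Λ.LocallyConvex] (v : Λ.TVert) (n : Fin k → ℕ) (f : Λ.Path)
    (hr : Λ.r f = v.key.1) (hf : f ∈ Λ.maxPaths n) :
    ∃ a : Λ.TPath, a.key = (f, v.key.2, n) := by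
  obtain ⟨x, hx⟩ := exists_boundaryPath Λ (Λ.s f)
  obtain ⟨h1, h2, -⟩ := BoundaryPath.concat_spec f x 0 (fun _ => by simp) hx.symm (Λ.d f) rfl 0
    le_rfl (fun _ => by simp)
  generalize BoundaryPath.concat f x 0 (fun _ => by simp) hx.symm = z at h1 h2
  have hz : ∀ i, z.deg i = Λ.d f i + x.deg i := by simpa using h1
  set m := v.key.2 with hm
  have hmi : ∀ i, m i ≠ 0 → Λ.d f i = 0 ∧ z.deg i = 0 := by
    intro i hi
    have h := v.pathsOf_eq_empty hi
    rw [← hr] at h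
    have h0 := d_eq_zero_of_pathsOf_eq_empty h
    refine ⟨h0, ?_⟩
    rw [hz, h0, x.deg_eq_zero (by rw [hx]; exact pathsOf_s_eq_empty h)]
    simp
  have hM : meet m z.deg = 0 := by
    funext i
    by_cases hi : m i = 0
    · simp [meet, hi]
    · simp [meet, (hmi i hi).2]
  have hN : meet (m + n) z.deg = Λ.d f := by
    funext i
    by_cases hi : m i = 0
    · by_cases hn : Λ.d f i < n i
      · have hd : z.deg i = Λ.d f i := by
          rw [hz, x.deg_eq_zero (by rw [hx]; exact hf.2 i hn), add_zero]
        simp only [meet, hd, Pi.add_apply, hi, zero_add]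
        rw [min_eq_right (Nat.cast_le.2 hn.le)]; rfl
      · have hn' : n i = Λ.d f i := le_antisymm (not_lt.1 hn) (hf.1 i)
        simp only [meet, Pi.add_apply, hi, zero_add, hn']
        rw [min_eq_left (by rw [hz]; exact le_self_add)]; rfl
    · simp [meet, (hmi i hi).2, (hmi i hi).1]
  refine ⟨TPath.mk z m (m + n) le_self_add, Prod.ext ?_ (Prod.ext ?_ ?_)⟩
  · refine (z.seg_congr hM hN (meet_mono le_self_add _) (meet_le_right _ _)).trans (h2 ?_)
    intro i; rw [hz]; exact le_self_add
  · change m - meet m z.deg = m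
    rw [hM, tsub_zero]
  · change m + n - m = n
    simp

end keys

section desource
variable {Λ : KGraph.{u} k} [Λ.LocallyConvex]

/-- The base and the excess of a vertex of `Λ̃`. -/
def vertKey (v : Λ.desourcification.Vert) : Λ.Vert × (Fin k → ℕ) := TVert.key v

/-- The base, the excess of the range and the degree of a path of `Λ̃`. -/
def pathKey (a : Λ.desourcification.Path) : Λ.Path × (Fin k → ℕ) × (Fin k → ℕ) := TPath.key a

theorem vertKey_injective : Function.Injective (vertKey (Λ := Λ)) := TVert.key_injective
theorem pathKey_injective : Function.Injective (pathKey (Λ := Λ)) := TPath.key_injective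

theorem vertKey_r (a : Λ.desourcification.Path) :
    vertKey (Λ.desourcification.r a) = (Λ.r (pathKey a).1, (pathKey a).2.1) := TPath.key_r a

theorem vertKey_s (a : Λ.desourcification.Path) :
    vertKey (Λ.desourcification.s a) =
      (Λ.s (pathKey a).1, (pathKey a).2.1 + (pathKey a).2.2 - Λ.d (pathKey a).1) := TPath.key_s a

theorem d_eq_pathKey (a : Λ.desourcification.Path) :
    Λ.desourcification.d a = (pathKey a).2.2 := TPath.key_d a

theorem pathKey_one (v : Λ.desourcification.Vert) :
    pathKey (Λ.desourcification.one v) = (Λ.one (vertKey v).1, (vertKey v).2, 0) := TVert.key_one v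

theorem pathKey_mem_maxPaths (a : Λ.desourcification.Path) :
    (pathKey a).1 ∈ Λ.maxPaths (pathKey a).2.2 := TPath.key_mem_maxPaths a

theorem exists_pathKey_eq (v : Λ.desourcification.Vert) (n : Fin k → ℕ) (f : Λ.Path)
    (hr : Λ.r f = (vertKey v).1) (hf : f ∈ Λ.maxPaths n) :
    ∃ a : Λ.desourcification.Path, pathKey a = (f, (vertKey v).2, n) :=
  TVert.exists_path v n f hr hf

theorem IsComp.pathKey {a b c : Λ.desourcification.Path} (H : Λ.desourcification.IsComp a b c) :
    Λ.IsComp (pathKey a).1 (pathKey b).1 (pathKey c).1 := by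
  obtain ⟨h, rfl⟩ := H
  exact (TPath.key_comp a b h).1

theorem isComp_of_pathKey {a b c : Λ.desourcification.Path}
    (h : Λ.desourcification.s a = Λ.desourcification.r b)
    (H : Λ.IsComp (pathKey a).1 (pathKey b).1 (pathKey c).1)
    (h' : (pathKey c).2 = ((pathKey a).2.1, (pathKey a).2.2 + (pathKey b).2.2)) :
    Λ.desourcification.IsComp a b c := by
  obtain ⟨h1, h2, -⟩ := TPath.key_comp a b h
  exact ⟨h, TPath.key_ext (h1.unique H) (h2.trans h'.symm)⟩

theorem pathKey_iotaPath (f : Λ.Path) : pathKey (Λ.iotaPath f) = (f, 0, Λ.d f) :=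
  iotaPathOf_key _ _ _

theorem vertKey_iotaVert (v : Λ.Vert) : vertKey (Λ.iotaVert v) = (v, 0) := by
  have hm : meet (0 : Fin k → ℕ) (Λ.someBoundaryPath v).deg = 0 := by funext i; simp [meet]
  refine Prod.ext ?_ ?_
  · exact (BoundaryPath.vert_congr _ hm (meet_le_right _ _)).trans (Λ.someBoundaryPath_range v)
  · change 0 - meet _ _ = 0
    simp

theorem iotaVert_injective : Function.Injective Λ.iotaVert := fun v w h => by
  have := congrArg vertKey h
  rw [vertKey_iotaVert, vertKey_iotaVert] at this
  exact congrArg Prod.fst this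

theorem r_iotaPath (f : Λ.Path) : Λ.desourcification.r (Λ.iotaPath f) = Λ.iotaVert (Λ.r f) :=
  vertKey_injective (by rw [vertKey_r, pathKey_iotaPath, vertKey_iotaVert])

theorem s_iotaPath (f : Λ.Path) : Λ.desourcification.s (Λ.iotaPath f) = Λ.iotaVert (Λ.s f) :=
  vertKey_injective (by rw [vertKey_s, pathKey_iotaPath, vertKey_iotaVert]; simp)

theorem iotaPath_one (v : Λ.Vert) : Λ.iotaPath (Λ.one v) = Λ.desourcification.one (Λ.iotaVert v) :=
  pathKey_injective (by rw [pathKey_iotaPath, pathKey_one, vertKey_iotaVert, Λ.d_one])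

theorem isComp_iotaPath {f g h : Λ.Path} (H : Λ.IsComp f g h) :
    Λ.desourcification.IsComp (Λ.iotaPath f) (Λ.iotaPath g) (Λ.iotaPath h) :=
  isComp_of_pathKey (by rw [s_iotaPath, r_iotaPath, H.1])
    (by rw [pathKey_iotaPath, pathKey_iotaPath, pathKey_iotaPath]; exact H)
    (by rw [pathKey_iotaPath, pathKey_iotaPath, pathKey_iotaPath, H.deg])

/-- A path `λ` of `Λ̃` with range in `ι(Λ^0)` starts with `ι` of its base; the rest of it is a path
with base a vertex. -/
theorem exists_isComp_iotaPath (a : Λ.desourcification.Path)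
    (ha : Λ.desourcification.r a ∈ Set.range Λ.iotaVert) :
    ∃ b : Λ.desourcification.Path, Λ.desourcification.IsComp (Λ.iotaPath (pathKey a).1) b a ∧
      pathKey b = (Λ.one (Λ.s (pathKey a).1), 0, (pathKey a).2.2 - Λ.d (pathKey a).1) := by
  have h0 : (pathKey a).2.1 = 0 := by
    obtain ⟨v, hv⟩ := ha
    have h1 := vertKey_r a
    rw [← hv, vertKey_iotaVert] at h1
    exact (congrArg Prod.snd h1).symm
  have hmax := pathKey_mem_maxPaths a
  obtain ⟨b, hb⟩ := (exists_pathKey_eq (Λ.iotaVert (Λ.s (pathKey a).1))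
    ((pathKey a).2.2 - Λ.d (pathKey a).1) (Λ.one (Λ.s (pathKey a).1))
    (by rw [vertKey_iotaVert, Λ.r_one]) ⟨by rw [Λ.d_one]; exact fun _ => Nat.zero_le _, fun i hi => by
      rw [Λ.d_one] at hi
      simp only [Pi.zero_apply, Pi.sub_apply] at hi
      rw [Λ.s_one]
      exact hmax.2 i (by omega)⟩)
  rw [vertKey_iotaVert] at hb
  refine ⟨b, isComp_of_pathKey ?_ ?_ ?_, hb⟩
  · rw [s_iotaPath]
    exact vertKey_injective (by rw [vertKey_r, vertKey_iotaVert, hb, Λ.r_one])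
  · rw [pathKey_iotaPath, hb]
    exact isComp_one _
  · rw [pathKey_iotaPath, hb]
    exact Prod.ext h0 (add_tsub_cancel_of_le hmax.1).symm

/-- The base maps `vΛ̃^n` injectively into `Λ`. -/
theorem eq_of_pathKey_fst_eq {v : Λ.desourcification.Vert} {n : Fin k → ℕ}
    {a b : Λ.desourcification.Path} (ha : a ∈ Λ.desourcification.maxPathsOf v n)
    (hb : b ∈ Λ.desourcification.maxPathsOf v n) (h : (pathKey a).1 = (pathKey b).1) : a = b := by
  have hr := congrArg vertKey (ha.1.trans hb.1.symm)
  rw [vertKey_r, vertKey_r] at hr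
  have hd := (Λ.desourcification_noSources.mem_maxPaths_iff.1 ha.2).trans
    (Λ.desourcification_noSources.mem_maxPaths_iff.1 hb.2).symm
  rw [d_eq_pathKey, d_eq_pathKey] at hd
  exact pathKey_injective (Prod.ext h (Prod.ext (congrArg Prod.snd hr) hd))

/-- The base maps `vΛ̃^n` into `wΛ^{≤ n}`, where `w` is the base of `v`. -/
theorem pathKey_fst_mem {v : Λ.desourcification.Vert} {n : Fin k → ℕ}
    {a : Λ.desourcification.Path} (ha : a ∈ Λ.desourcification.maxPathsOf v n) :
    (pathKey a).1 ∈ Λ.maxPathsOf (vertKey v).1 n := by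
  refine ⟨?_, ?_⟩
  · rw [← ha.1, vertKey_r]
  · have h := pathKey_mem_maxPaths a
    rwa [← d_eq_pathKey, Λ.desourcification_noSources.mem_maxPaths_iff.1 ha.2] at h

/-- The base maps `vΛ̃^n` onto `wΛ^{≤ n}`, where `w` is the base of `v`. -/
theorem exists_mem_pathKey_fst_eq {v : Λ.desourcification.Vert} {n : Fin k → ℕ} {f : Λ.Path}
    (hf : f ∈ Λ.maxPathsOf (vertKey v).1 n) :
    ∃ a ∈ Λ.desourcification.maxPathsOf v n, (pathKey a).1 = f := by
  obtain ⟨a, ha⟩ := exists_pathKey_eq v n f hf.1 hf.2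
  refine ⟨a, ⟨vertKey_injective ?_, Λ.desourcification_noSources.mem_maxPaths_iff.2 ?_⟩, ?_⟩
  · rw [vertKey_r, ha, hf.1]
  · rw [d_eq_pathKey, ha]
  · rw [ha]

section KP
variable {R : Type v} [CommRing R] [Λ.RowFinite]

/-- A path of `Λ̃` with range in `ι(Λ^0)` and base a vertex is the only one of its range and degree. -/
theorem s_mul_t_eq_p_of_key {b : Λ.desourcification.Path} {v : Λ.Vert} {n : Fin k → ℕ}
    (hb : pathKey b = (Λ.one v, 0, n)) :
    KP.s R Λ.desourcification b * KP.t R Λ.desourcification b =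
      KP.p R Λ.desourcification (Λ.iotaVert v) := by
  have hbm : b ∈ Λ.desourcification.maxPathsOf (Λ.iotaVert v) n :=
    ⟨vertKey_injective (by rw [vertKey_r, vertKey_iotaVert, hb, Λ.r_one]),
      Λ.desourcification_noSources.mem_maxPaths_iff.2 (by rw [d_eq_pathKey, hb])⟩
  have hsrc := (pathKey_fst_mem hbm).2.2
  rw [hb, Λ.s_one, Λ.d_one] at hsrc
  have huniq : (Λ.desourcification.maxPathsOf_finite (Λ.iotaVert v) n).toFinset = {b} := by
    ext a
    rw [Set.Finite.mem_toFinset, Finset.mem_singleton]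
    refine ⟨fun ha => eq_of_pathKey_fst_eq ha hbm ?_, fun h => h ▸ hbm⟩
    have ha' := pathKey_fst_mem ha
    rw [vertKey_iotaVert] at ha'
    have hd0 : Λ.d (pathKey a).1 = 0 := by
      funext i
      by_contra hc
      have h5 := hsrc i (lt_of_lt_of_le (Nat.pos_of_ne_zero hc) (ha'.2.1 i))
      have h6 : Λ.r (pathKey a).1 = v := ha'.1
      rw [← h6] at h5
      exact hc (d_eq_zero_of_pathsOf_eq_empty h5)
    rw [eq_one_of_d _ hd0, ha'.1, hb]
  rw [KP.p_eq_sum _ n, huniq, Finset.sum_singleton]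

theorem s_mul_t_eq_of_isComp {f g : Λ.Path} {a b c : Λ.desourcification.Path} {v : Λ.Vert}
    {n : Fin k → ℕ} (hb : pathKey b = (Λ.one v, 0, n)) (hf : Λ.s f = v)
    (ha : Λ.desourcification.IsComp (Λ.iotaPath f) b a)
    (hc : Λ.desourcification.IsComp (Λ.iotaPath g) b c) :
    KP.s R Λ.desourcification a * KP.t R Λ.desourcification c =
      KP.s R Λ.desourcification (Λ.iotaPath f) * KP.t R Λ.desourcification (Λ.iotaPath g) := by
  rw [← KP.s_mul_s ha, ← KP.t_mul_t hc, mul_assoc, ← mul_assoc (KP.s R Λ.desourcification b),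
    s_mul_t_eq_p_of_key hb, ← mul_assoc, ← hf, ← s_iotaPath, KP.s_mul_p]

variable (R Λ) in
/-- The Kumjian-Pask `Λ`-family `(q_{ι(v)}, t_{ι(λ)}, t_{ι(λ)^*})` in `KP_R(Λ̃)`. -/
def iotaFamily : KPFamily Λ (KP R Λ.desourcification) where
  p v := KP.p R _ (Λ.iotaVert v)
  s f := KP.s R _ (Λ.iotaPath f)
  t f := KP.t R _ (Λ.iotaPath f)
  path_one v := by rw [iotaPath_one, KP.s_one]
  ghost_one v := by rw [iotaPath_one, KP.t_one]
  p_mul_self v := KP.p_mul_self _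
  p_mul_ne v w h := KP.p_mul_ne (iotaVert_injective.ne h)
  s_mul_s f g h H := KP.s_mul_s (isComp_iotaPath H)
  t_mul_t f g h H := KP.t_mul_t (isComp_iotaPath H)
  p_mul_s f := by rw [← r_iotaPath, KP.p_mul_s]
  s_mul_p f := by rw [← s_iotaPath, KP.s_mul_p]
  p_mul_t f := by rw [← s_iotaPath, KP.p_mul_t]
  t_mul_p f := by rw [← r_iotaPath, KP.t_mul_p]
  t_mul_s_self f := by rw [← s_iotaPath, KP.t_mul_s_self]
  t_mul_s_ne n f hf g hg h := by
    obtain ⟨a, ham, rfl⟩ := exists_mem_pathKey_fst_eq (v := Λ.iotaVert (Λ.r f)) (f := f)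
      ⟨by rw [vertKey_iotaVert], hf⟩
    obtain ⟨c, hcm, rfl⟩ := exists_mem_pathKey_fst_eq (v := Λ.iotaVert (Λ.r g)) (f := g)
      ⟨by rw [vertKey_iotaVert], hg⟩
    obtain ⟨b, hab, hb⟩ := exists_isComp_iotaPath a ⟨_, ham.1.symm⟩
    obtain ⟨d, hcd, hd⟩ := exists_isComp_iotaPath c ⟨_, hcm.1.symm⟩
    rw [← KP.p_mul_t, ← KP.s_mul_p, s_iotaPath, s_iotaPath, ← s_mul_t_eq_p_of_key hb,
      ← s_mul_t_eq_p_of_key hd, mul_assoc (KP.s R _ b), KP.t_mul_t hab, mul_assoc,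
      ← mul_assoc (KP.s R _ (Λ.iotaPath _)), KP.s_mul_s hcd, ← mul_assoc (KP.t R _ a),
      KP.t_mul_s_ne ham.2 hcm.2 (fun hac => h (by rw [hac])), zero_mul, mul_zero]
  p_eq_sum v n := by
    rw [KP.p_eq_sum _ n]
    refine Finset.sum_bij (fun a _ => (pathKey a).1) ?_ ?_ ?_ ?_
    · intro a ha
      rw [Set.Finite.mem_toFinset] at ha ⊢
      simpa only [vertKey_iotaVert] using pathKey_fst_mem ha
    · intro a ha c hc hac
      rw [Set.Finite.mem_toFinset] at ha hc
      exact eq_of_pathKey_fst_eq ha hc hac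
    · intro f hf
      rw [Set.Finite.mem_toFinset] at hf
      have hv : (vertKey (Λ.iotaVert v)).1 = v := by rw [vertKey_iotaVert]
      rw [← hv] at hf
      obtain ⟨a, ha, haf⟩ := exists_mem_pathKey_fst_eq hf
      exact ⟨a, (Set.Finite.mem_toFinset _).2 ha, haf⟩
    · intro a ha
      rw [Set.Finite.mem_toFinset] at ha
      obtain ⟨b, hab, hb⟩ := exists_isComp_iotaPath a ⟨v, ha.1.symm⟩
      exact s_mul_t_eq_of_isComp hb rfl hab hab

end KP

end desource

/-! ### Matrix units -/

section matrix
variable {R ι A : Type*} [CommRing R] [DecidableEq ι] [NonUnitalRing A] [Module R A]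
  [IsScalarTower R A A] [SMulCommClass R A A]

variable (R) in
/-- The matrix with the only entry `a` at `(m, n)`, as an operator on columns with entries in the
unitization of `A`. -/
def matUnit (m n : ι) : A →+ Module.End R (ι → Unitization R A) where
  toFun a := (LinearMap.single R _ m) ∘ₗ (LinearMap.mulLeft R (a : Unitization R A)) ∘ₗ
    LinearMap.proj n
  map_zero' := by ext1 φ; simp
  map_add' a b := by
    refine LinearMap.ext fun φ => ?_
    simp [add_mul, Pi.single_add]

theorem matUnit_apply (m n : ι) (a : A) (φ : ι → Unitization R A) :
    matUnit R m n a φ = Pi.single m ((a : Unitization R A) * φ n) := rfl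

theorem matUnit_mul (m n l : ι) (a b : A) :
    matUnit R m n a * matUnit R n l b = matUnit R m l (a * b) := by
  refine LinearMap.ext fun φ => ?_
  rw [Module.End.mul_apply, matUnit_apply, matUnit_apply, matUnit_apply, Pi.single_eq_same,
    Unitization.inr_mul, mul_assoc]

theorem matUnit_mul_ne (m l : ι) {n n' : ι} (h : n ≠ n') (a b : A) :
    matUnit R m n a * matUnit R n' l b = 0 := by
  refine LinearMap.ext fun φ => ?_
  rw [Module.End.mul_apply, matUnit_apply, matUnit_apply, Pi.single_eq_of_ne h, mul_zero,
    Pi.single_zero, LinearMap.zero_apply]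

theorem matUnit_smul (c : R) (m n : ι) (a : A) :
    matUnit R m n (c • a) = c • matUnit R m n a := by
  refine LinearMap.ext fun φ => ?_
  rw [LinearMap.smul_apply, matUnit_apply, matUnit_apply, Unitization.inr_smul, smul_mul_assoc,
    Pi.single_smul]

theorem matUnit_injective (m n : ι) : Function.Injective (matUnit R (A := A) m n) := by
  intro a b h
  have h1 := congrFun (LinearMap.congr_fun h fun _ => 1) m
  rw [matUnit_apply, matUnit_apply, Pi.single_eq_same, Pi.single_eq_same, mul_one, mul_one] at h1
  exact Unitization.inr_injective h1

variable (R A) in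
/-- The diagonal embedding at the position `m`. -/
def matDiag (m : ι) : A →ₙₐ[R] Module.End R (ι → Unitization R A) :=
  { matUnit R m m with
    map_smul' := fun c a => matUnit_smul c m m a
    map_mul' := fun a b => (matUnit_mul m m m a b).symm }

end matrix

section matFamily
variable (Λ : KGraph.{u} k) [Λ.LocallyConvex] [Λ.RowFinite] (R : Type v) [CommRing R]

/-- The Kumjian-Pask `Λ̃`-family of matrices over `KP_R(Λ)`. -/
def matFamily : KPFamily Λ.desourcification
    (Module.End R ((Fin k → ℕ) → Unitization R (KP R Λ))) where
  p v := matUnit R (vertKey v).2 (vertKey v).2 (KP.p R Λ (vertKey v).1)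
  s a := matUnit R (vertKey (Λ.desourcification.r a)).2 (vertKey (Λ.desourcification.s a)).2 (KP.s R Λ (pathKey a).1)
  t a := matUnit R (vertKey (Λ.desourcification.s a)).2 (vertKey (Λ.desourcification.r a)).2 (KP.t R Λ (pathKey a).1)
  path_one v := by
    change matUnit R (vertKey (Λ.desourcification.r (Λ.desourcification.one v))).2 (vertKey (Λ.desourcification.s (Λ.desourcification.one v))).2
      (KP.s R Λ (pathKey (Λ.desourcification.one v)).1) = _
    rw [Λ.desourcification.r_one, Λ.desourcification.s_one, pathKey_one, KP.s_one]
  ghost_one v := by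
    change matUnit R (vertKey (Λ.desourcification.s (Λ.desourcification.one v))).2 (vertKey (Λ.desourcification.r (Λ.desourcification.one v))).2
      (KP.t R Λ (pathKey (Λ.desourcification.one v)).1) = _
    rw [Λ.desourcification.r_one, Λ.desourcification.s_one, pathKey_one, KP.t_one]
  p_mul_self v := by rw [matUnit_mul, KP.p_mul_self]
  p_mul_ne v w h := by
    by_cases h2 : (vertKey v).2 = (vertKey w).2
    · rw [h2, matUnit_mul, KP.p_mul_ne fun h1 => h (vertKey_injective (Prod.ext h1 h2)), map_zero]
    · exact matUnit_mul_ne _ _ h2 _ _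
  s_mul_s f g h H := by
    have h1 : Λ.desourcification.s f = Λ.desourcification.r g := H.1
    have h2 : Λ.desourcification.r h = Λ.desourcification.r f := H.r
    have h3 : Λ.desourcification.s h = Λ.desourcification.s g := H.s
    rw [h1, h2, h3, matUnit_mul, KP.s_mul_s H.pathKey]
  t_mul_t f g h H := by
    have h1 : Λ.desourcification.s f = Λ.desourcification.r g := H.1
    have h2 : Λ.desourcification.r h = Λ.desourcification.r f := H.r
    have h3 : Λ.desourcification.s h = Λ.desourcification.s g := H.s
    rw [h1, h2, h3, matUnit_mul, KP.t_mul_t H.pathKey]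
  p_mul_s f := by
    change matUnit R (vertKey (Λ.desourcification.r f)).2 (vertKey (Λ.desourcification.r f)).2
      (KP.p R Λ (vertKey (Λ.desourcification.r f)).1) * _ = _
    rw [matUnit_mul, congrArg Prod.fst (vertKey_r f), KP.p_mul_s]
  s_mul_p f := by
    change _ * matUnit R (vertKey (Λ.desourcification.s f)).2 (vertKey (Λ.desourcification.s f)).2
      (KP.p R Λ (vertKey (Λ.desourcification.s f)).1) = _
    rw [matUnit_mul, congrArg Prod.fst (vertKey_s f), KP.s_mul_p]
  p_mul_t f := by
    change matUnit R (vertKey (Λ.desourcification.s f)).2 (vertKey (Λ.desourcification.s f)).2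
      (KP.p R Λ (vertKey (Λ.desourcification.s f)).1) * _ = _
    rw [matUnit_mul, congrArg Prod.fst (vertKey_s f), KP.p_mul_t]
  t_mul_p f := by
    change _ * matUnit R (vertKey (Λ.desourcification.r f)).2 (vertKey (Λ.desourcification.r f)).2
      (KP.p R Λ (vertKey (Λ.desourcification.r f)).1) = _
    rw [matUnit_mul, congrArg Prod.fst (vertKey_r f), KP.t_mul_p]
  t_mul_s_self f := by
    change _ = matUnit R (vertKey (Λ.desourcification.s f)).2 (vertKey (Λ.desourcification.s f)).2
      (KP.p R Λ (vertKey (Λ.desourcification.s f)).1)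
    rw [matUnit_mul, KP.t_mul_s_self, congrArg Prod.fst (vertKey_s f)]
  t_mul_s_ne n f hf g hg h := by
    by_cases hr : (vertKey (Λ.desourcification.r f)).2 = (vertKey (Λ.desourcification.r g)).2
    · have hd := (Λ.desourcification_noSources.mem_maxPaths_iff.1 hf).trans
        (Λ.desourcification_noSources.mem_maxPaths_iff.1 hg).symm
      have hne : (pathKey f).1 ≠ (pathKey g).1 := fun h1 => h (pathKey_injective (Prod.ext h1
        (Prod.ext (by rwa [vertKey_r, vertKey_r] at hr)
          (by rwa [d_eq_pathKey, d_eq_pathKey] at hd))))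
      rw [hr, matUnit_mul, KP.t_mul_s_ne (pathKey_fst_mem ⟨rfl, hf⟩).2 (pathKey_fst_mem ⟨rfl, hg⟩).2
        hne, map_zero]
    · exact matUnit_mul_ne _ _ hr _ _
  p_eq_sum v n := by
    rw [KP.p_eq_sum _ n, map_sum]
    refine (Finset.sum_bij (fun a _ => (pathKey a).1) ?_ ?_ ?_ ?_).symm
    · intro a ha
      rw [Set.Finite.mem_toFinset] at ha ⊢
      exact pathKey_fst_mem ha
    · intro a ha c hc hac
      rw [Set.Finite.mem_toFinset] at ha hc
      exact eq_of_pathKey_fst_eq ha hc hac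
    · intro f hf
      rw [Set.Finite.mem_toFinset] at hf
      obtain ⟨a, ha, haf⟩ := exists_mem_pathKey_fst_eq hf
      exact ⟨a, (Set.Finite.mem_toFinset _).2 ha, haf⟩
    · intro a ha
      rw [Set.Finite.mem_toFinset] at ha
      rw [matUnit_mul, ha.1]

theorem iotaFamily_lift_injective : Function.Injective ((iotaFamily Λ R).lift R) := by
  have key : ∀ x, (matFamily Λ R).lift R ((iotaFamily Λ R).lift R x) =
      matDiag R (KP R Λ) (0 : Fin k → ℕ) x := by
    intro x
    refine KP.mem_of_generators
      (NonUnitalAlgHom.equalizer (((matFamily Λ R).lift R).comp ((iotaFamily Λ R).lift R))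
        (matDiag R (KP R Λ) (0 : Fin k → ℕ))) ?_ ?_ ?_ x
    · intro v
      change (matFamily Λ R).lift R ((iotaFamily Λ R).lift R (KP.p R Λ v)) = _
      rw [KPFamily.lift_p]
      refine (KPFamily.lift_p _ _).trans ?_
      change matUnit R _ _ _ = matUnit R _ _ _
      rw [vertKey_iotaVert]
    · intro f
      change (matFamily Λ R).lift R ((iotaFamily Λ R).lift R (KP.s R Λ f)) = _
      rw [KPFamily.lift_s]
      refine (KPFamily.lift_s _ _).trans ?_
      change matUnit R _ _ _ = matUnit R _ _ _
      rw [vertKey_r, vertKey_s, pathKey_iotaPath]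
      simp
    · intro f
      change (matFamily Λ R).lift R ((iotaFamily Λ R).lift R (KP.t R Λ f)) = _
      rw [KPFamily.lift_t]
      refine (KPFamily.lift_t _ _).trans ?_
      change matUnit R _ _ _ = matUnit R _ _ _
      rw [vertKey_r, vertKey_s, pathKey_iotaPath]
      simp
  intro x y hxy
  have h := (key x).symm.trans ((congrArg _ hxy).trans (key y))
  exact matUnit_injective 0 0 h

end matFamily

section Morita
variable {R : Type v} [CommRing R] {Λ : KGraph.{u} k} [Λ.LocallyConvex] [Λ.RowFinite]

theorem modM_eq_corner :
    Λ.modM R = corner R Λ.desourcification Set.univ (Set.range Λ.iotaVert) := by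
  simp [modM, corner]

theorem modN_eq_corner :
    Λ.modN R = corner R Λ.desourcification (Set.range Λ.iotaVert) Set.univ := by
  simp [modN, corner]

theorem mem_algB_iff (x : KP R Λ.desourcification) :
    x ∈ Λ.algB R ↔
      x ∈ corner R Λ.desourcification (Set.range Λ.iotaVert) (Set.range Λ.iotaVert) := by
  constructor
  · intro h
    refine (NonUnitalAlgebra.adjoin_le ?_ :
      Λ.algB R ≤ Λ.desourcification_noSources.cornerSubalgebra (Set.range Λ.iotaVert)) h
    rintro _ ((⟨v, rfl⟩ | ⟨f, rfl⟩) | ⟨f, rfl⟩)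
    · exact p_mem_corner ⟨v, rfl⟩ ⟨v, rfl⟩
    · exact s_mem_corner ⟨_, (r_iotaPath f).symm⟩ ⟨_, (s_iotaPath f).symm⟩
    · exact t_mem_corner ⟨_, (s_iotaPath f).symm⟩ ⟨_, (r_iotaPath f).symm⟩
  · intro h
    refine (Submodule.span_le (p := (Λ.algB R).toSubmodule)).2 ?_ h
    rintro _ ⟨f, g, hf, hg, rfl⟩
    by_cases hs : Λ.desourcification.s f = Λ.desourcification.s g
    · obtain ⟨a, ha, hak⟩ := exists_isComp_iotaPath f hf
      obtain ⟨b, hb, hbk⟩ := exists_isComp_iotaPath g hg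
      have hab : a = b := by
        have hsk := congrArg vertKey (ha.s.symm.trans (hs.trans hb.s))
        rw [vertKey_s, vertKey_s, hak, hbk] at hsk
        refine pathKey_injective ?_
        rw [hak, hbk]
        simp only [Prod.mk.injEq, Λ.s_one, Λ.d_one, zero_add, tsub_zero] at hsk
        rw [hsk.1, hsk.2]
      rw [← hab] at hb
      rw [s_mul_t_eq_of_isComp hak rfl ha hb]
      exact (Λ.algB R).mul_mem (NonUnitalAlgebra.subset_adjoin R (Or.inl (Or.inr ⟨_, rfl⟩)))
        (NonUnitalAlgebra.subset_adjoin R (Or.inr ⟨_, rfl⟩))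
    · rw [KP.s_mul_t_ne hs]
      exact zero_mem _

theorem iotaFamily_lift_mem (x : KP R Λ) : (iotaFamily Λ R).lift R x ∈ Λ.algB R := by
  refine KP.mem_of_generators ((Λ.algB R).comap ((iotaFamily Λ R).lift R)) ?_ ?_ ?_ x
  · intro v
    change (iotaFamily Λ R).lift R (KP.p R Λ v) ∈ Λ.algB R
    rw [KPFamily.lift_p]
    exact NonUnitalAlgebra.subset_adjoin R (Or.inl (Or.inl ⟨_, rfl⟩))
  · intro f
    change (iotaFamily Λ R).lift R (KP.s R Λ f) ∈ Λ.algB R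
    rw [KPFamily.lift_s]
    exact NonUnitalAlgebra.subset_adjoin R (Or.inl (Or.inr ⟨_, rfl⟩))
  · intro f
    change (iotaFamily Λ R).lift R (KP.t R Λ f) ∈ Λ.algB R
    rw [KPFamily.lift_t]
    exact NonUnitalAlgebra.subset_adjoin R (Or.inr ⟨_, rfl⟩)

theorem algB_le_range : Λ.algB R ≤ NonUnitalAlgHom.range ((iotaFamily Λ R).lift R) := by
  refine NonUnitalAlgebra.adjoin_le ?_
  rintro _ ((⟨v, rfl⟩ | ⟨f, rfl⟩) | ⟨f, rfl⟩)
  · exact (NonUnitalAlgHom.mem_range _).2 ⟨_, KPFamily.lift_p (iotaFamily Λ R) v⟩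
  · exact (NonUnitalAlgHom.mem_range _).2 ⟨_, KPFamily.lift_s (iotaFamily Λ R) f⟩
  · exact (NonUnitalAlgHom.mem_range _).2 ⟨_, KPFamily.lift_t (iotaFamily Λ R) f⟩

omit [Λ.RowFinite] in
/-- Every vertex of `Λ̃` is the source of a path with range in `ι(Λ^0)`. -/
theorem exists_path_to_iotaVert (v : Λ.desourcification.Vert) :
    ∃ f, Λ.desourcification.s f = v ∧ Λ.desourcification.r f ∈ Set.range Λ.iotaVert := by
  obtain ⟨v⟩ := v
  exact ⟨TPath.mk v.x 0 v.m (fun _ => Nat.zero_le _), rfl, _, iotaVert_eq _ v.x rfl⟩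

theorem mem_closure_modM_mul_modN (x : KP R Λ.desourcification) :
    x ∈ AddSubgroup.closure {x | ∃ m ∈ Λ.modM R, ∃ n ∈ Λ.modN R, m * n = x} := by
  have hx := Λ.desourcification_noSources.mem_corner_univ x
  induction hx using Submodule.closure_induction with
  | zero => exact zero_mem _
  | add x y _ _ hx hy => exact add_mem hx hy
  | smul_mem c x hx =>
    obtain ⟨f, g, -, -, rfl⟩ := hx
    obtain ⟨h, hs, hr⟩ := exists_path_to_iotaVert (Λ.desourcification.s f)
    refine AddSubgroup.subset_closure ⟨c • (KP.s R _ f * KP.t R _ h), ?_, KP.s R _ h * KP.t R _ g,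
      ?_, ?_⟩
    · rw [modM_eq_corner]
      exact Submodule.smul_mem _ c (s_mul_t_mem_corner (Set.mem_univ _) hr)
    · rw [modN_eq_corner]
      exact s_mul_t_mem_corner hr (Set.mem_univ _)
    · rw [smul_mul_assoc, mul_assoc, ← mul_assoc (KP.t R _ h), KP.t_mul_s_self, hs, ← mul_assoc,
        KP.s_mul_p]

theorem mem_closure_modN_mul_modM {x : KP R Λ.desourcification} (hx : x ∈ Λ.algB R) :
    x ∈ AddSubgroup.closure {x | ∃ n ∈ Λ.modN R, ∃ m ∈ Λ.modM R, n * m = x} := by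
  rw [mem_algB_iff] at hx
  induction hx using Submodule.closure_induction with
  | zero => exact zero_mem _
  | add x y _ _ hx hy => exact add_mem hx hy
  | smul_mem c x hx =>
    obtain ⟨f, g, hf, hg, rfl⟩ := hx
    refine AddSubgroup.subset_closure ⟨c • KP.s R _ f, ?_, KP.t R _ g, ?_, ?_⟩
    · rw [modN_eq_corner]
      exact Submodule.smul_mem _ c (s_mem_corner hf (Set.mem_univ _))
    · rw [modM_eq_corner]
      exact t_mem_corner (Set.mem_univ _) hg
    · rw [smul_mul_assoc]

/-- The Morita context of a ring embedded in `KP_R(Λ̃)` with image `B(Λ̃)`. -/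
theorem exists_moritaContext_desourcification {D : Type*} [NonUnitalRing D]
    (j : D →ₙ+* KP R Λ.desourcification) (hj : Function.Injective j)
    (hB : ∀ x, x ∈ Λ.algB R ↔ ∃ b, j b = x) :
    ∃ (X : RingBimod (KP R Λ.desourcification) D (Λ.modM R))
      (Y : RingBimod D (KP R Λ.desourcification) (Λ.modN R)),
      (∀ a (m : Λ.modM R), (X.l a m : KP R Λ.desourcification) = a * m) ∧
      (∀ b (m : Λ.modM R), (X.r b m : KP R Λ.desourcification) = m * j b) ∧
      (∀ b (n : Λ.modN R), (Y.l b n : KP R Λ.desourcification) = j b * n) ∧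
      (∀ a (n : Λ.modN R), (Y.r a n : KP R Λ.desourcification) = n * a) ∧
      ∃ C : MoritaContext X Y,
        (∀ m n, C.psi.toFun (RingBimod.tmul X Y m n) = m * n) ∧
        (∀ n m, j (C.phi.toFun (RingBimod.tmul Y X n m)) = n * m) ∧
        C.IsSurjective := by
  have hS := Λ.desourcification_noSources
  have hjB : ∀ b, j b ∈
      corner R Λ.desourcification (Set.range Λ.iotaVert) (Set.range Λ.iotaVert) :=
    fun b => (mem_algB_iff _).1 ((hB _).2 ⟨b, rfl⟩)
  refine exists_moritaContext_of_mul _ _ j hj ?_ ?_ ?_ ?_ ?_ mem_closure_modM_mul_modN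
    fun b => mem_closure_modN_mul_modM ((hB _).2 ⟨b, rfl⟩)
  · intro a m hm
    rw [modM_eq_corner] at hm ⊢
    exact hS.mul_mem_corner (hS.mem_corner_univ a) hm
  · intro m hm b
    rw [modM_eq_corner] at hm ⊢
    exact hS.mul_mem_corner hm (hjB b)
  · intro b n hn
    rw [modN_eq_corner] at hn ⊢
    exact hS.mul_mem_corner (hjB b) hn
  · intro n hn a
    rw [modN_eq_corner] at hn ⊢
    exact hS.mul_mem_corner hn (hS.mem_corner_univ a)
  · intro n hn m hm
    rw [← hB, mem_algB_iff]
    rw [modN_eq_corner] at hn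
    rw [modM_eq_corner] at hm
    exact hS.mul_mem_corner hn hm

end Morita

end KGraph

theorem corollary7p5 {k : ℕ} (hk : k ≠ 0) (Λ : KGraph.{u} k) [Λ.LocallyConvex] [Λ.RowFinite]
    (R : Type v) [CommRing R] :
    -- the Morita context between `KP_R(Λ̃)` and `B(Λ̃)`
    (∃ (X : RingBimod (KGraph.KP R Λ.desourcification) (Λ.algB R) (Λ.modM R))
        (Y : RingBimod (Λ.algB R) (KGraph.KP R Λ.desourcification) (Λ.modN R)),
      (∀ a (m : Λ.modM R), (X.l a m : KGraph.KP R Λ.desourcification) = a * m) ∧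
      (∀ (b : Λ.algB R) (m : Λ.modM R), (X.r b m : KGraph.KP R Λ.desourcification) = m * b) ∧
      (∀ (b : Λ.algB R) (n : Λ.modN R), (Y.l b n : KGraph.KP R Λ.desourcification) = b * n) ∧
      (∀ a (n : Λ.modN R), (Y.r a n : KGraph.KP R Λ.desourcification) = n * a) ∧
      ∃ C : MoritaContext X Y,
        (∀ m n, C.psi.toFun (RingBimod.tmul X Y m n) = m * n) ∧
        (∀ n m, (C.phi.toFun (RingBimod.tmul Y X n m) : KGraph.KP R Λ.desourcification) = n * m) ∧
        C.IsSurjective) ∧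
    -- the isomorphism `Φ : KP_R(Λ) → B(Λ̃)` and the resulting Morita context
    -- between `KP_R(Λ̃)` and `KP_R(Λ)`
    ∃ Φ : KGraph.KP R Λ →ₙₐ[R] Λ.algB R, Function.Bijective Φ ∧
      (∀ v, (Φ (KGraph.KP.p R Λ v) : KGraph.KP R Λ.desourcification) =
        KGraph.KP.p R Λ.desourcification (Λ.iotaVert v)) ∧
      (∀ f, (Φ (KGraph.KP.s R Λ f) : KGraph.KP R Λ.desourcification) =
        KGraph.KP.s R Λ.desourcification (Λ.iotaPath f)) ∧
      (∀ f, (Φ (KGraph.KP.t R Λ f) : KGraph.KP R Λ.desourcification) =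
        KGraph.KP.t R Λ.desourcification (Λ.iotaPath f)) ∧
      ∃ (X : RingBimod (KGraph.KP R Λ.desourcification) (KGraph.KP R Λ) (Λ.modM R))
        (Y : RingBimod (KGraph.KP R Λ) (KGraph.KP R Λ.desourcification) (Λ.modN R)),
        (∀ a (m : Λ.modM R), (X.l a m : KGraph.KP R Λ.desourcification) = a * m) ∧
        (∀ b (m : Λ.modM R), (X.r b m : KGraph.KP R Λ.desourcification) = m * Φ b) ∧
        (∀ b (n : Λ.modN R), (Y.l b n : KGraph.KP R Λ.desourcification) = Φ b * n) ∧
        (∀ a (n : Λ.modN R), (Y.r a n : KGraph.KP R Λ.desourcification) = n * a) ∧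
        ∃ C : MoritaContext X Y,
          (∀ m n, C.psi.toFun (RingBimod.tmul X Y m n) = m * n) ∧
          (∀ n m, (Φ (C.phi.toFun (RingBimod.tmul Y X n m)) : KGraph.KP R Λ.desourcification) =
            n * m) ∧
          C.IsSurjective := by
  refine ⟨?_, ?_⟩
  · exact KGraph.exists_moritaContext_desourcification
      (NonUnitalSubalgebraClass.subtype (Λ.algB R) : Λ.algB R →ₙ+* KGraph.KP R Λ.desourcification)
      Subtype.val_injective fun x => ⟨fun hx => ⟨⟨x, hx⟩, rfl⟩, fun ⟨b, hb⟩ => hb ▸ b.2⟩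
  · have hinj := KGraph.iotaFamily_lift_injective Λ R
    refine ⟨NonUnitalAlgHom.codRestrict ((KGraph.iotaFamily Λ R).lift R) (Λ.algB R) KGraph.iotaFamily_lift_mem,
      ⟨fun x y h => hinj (congrArg Subtype.val h), fun b => ?_⟩, fun v => KGraph.KPFamily.lift_p _ v,
      fun f => KGraph.KPFamily.lift_s _ f, fun f => KGraph.KPFamily.lift_t _ f, ?_⟩
    · obtain ⟨x, hx⟩ := KGraph.algB_le_range b.2
      exact ⟨x, Subtype.ext hx⟩
    · exact KGraph.exists_moritaContext_desourcification
        ((KGraph.iotaFamily Λ R).lift R : KGraph.KP R Λ →ₙ+* KGraph.KP R Λ.desourcification) hinj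
        fun x => ⟨fun hx => KGraph.algB_le_range hx,
          fun ⟨b, hb⟩ => hb ▸ KGraph.iotaFamily_lift_mem b⟩

end
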